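/- Consider eight parties $v_1,\dots,v_8$ whose local quantum systems have the dimensions $\boldsymbol d_0=(4,4,4,4,4,4,4,2)$: each of $v_1,\dots,v_7$ holds a target qubit $\mathcal H^{v_k}$ and an auxiliary qubit $\mathcal H_{\mathrm a}^{v_k}$, and $v_8$ holds one target qubit $\mathcal H^{v_8}$. States of the eight target qubits are regarded as states of the total system by putting all auxiliary qubits in $|0\rangle$. Let $p(1)=2$, $p(2)=p(3)=4$, $p(5)=6$, $p(4)=p(6)=p(7)=8$. For $\boldsymbol\alpha=(\alpha_1,\dots,\alpha_7)$ with $0\le\alpha_i<2\pi$ let $|\psi(\boldsymbol\alpha)\rangle=\prod_{i=1}^{7}\exp\bigl(\mathrm i\alpha_i Z^{v_i}\otimes Z^{v_{p(i)}}\bigr)\,|+\rangle^{\otimes 8}$ (a circuit with gates on $v_1v_2,\,v_3v_4,\,v_5v_6,\,v_7v_8$, then $v_2v_4,\,v_6v_8$, then $v_4v_8$), and let $S_0$ be the set of all these states. Let $|\Phi_{\mathrm{res}}\rangle$ be the 15-qubit graph state of the tree in which, for $i=1,\dots,7$, the auxiliary qubit of $v_i$ is joined to the target qubits of $v_i$ and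 of $v_{p(i)}$. LOCC within $\boldsymbol d_0$ means finitely many rounds in which one party performs a measurement on its own system (any Kraus operators $M_j$ on that system with $\sum_j M_j^\dagger M_j=1$, no added auxiliary system) and announces the outcome, on which all later steps may depend. A round of quantum communication moves the state of a subsystem of one party into a subsystem of the same dimension of another party that is in the state $|0\rangle$, and leaves the sender's subsystem in $|0\rangle$. A resource state $|\phi\rangle$ of the total system achieves the preparation of $S_0$ in the static setting if for every $|\psi\rangle\in S_0$ some LOCC protocol within $\boldsymbol d_0$ transforms $|\phi\rangle$ into $|\psi\rangle$ deterministically and exactly; it does so in the dynamic setting if, in addition, $|\phi\rangle$ itself can be prepared deterministically from $|0\cdots0\rangle$ by LOCC within $\boldsymbol d_0$ and finitely many rounds of quantum communication. A state consists of bipartite entanglement if, up to local unitaries (isometries into the local systems), it is a tensor product $\bigotimes_{e\in E}|\phi_e\rangle^e$ of bipartite entangled states shared along the edges of a graph on the parties. Then $|\Phi_{\mathrm{res}}\rangle$ is a fully entangled state (entangled across every bipartition of the parties) that achieves the preparation of $S_0$ in the dynamic setting within $\boldsymbol d_0$; moreover it can be prepared from $|0\cdots0\rangle$ by a fixed sequence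 of initializations of single qubits as $|+\rangle$, $CZ$ gates on the two qubits of one party, and communications of single qubits. In contrast, no state consisting of bipartite entanglement achieves the preparation of $S_0$ in the static setting within $\boldsymbol d_0$. -/

import Mathlib

noncomputable section

namespace SizeLimited

/-! ### Multipartite systems of limited size -/

/-- Labels of the product basis of the total system of the parties `v_1, …, v_N`, where party `k`
holds a quantum system of dimension `d k`. -/
abbrev Config {N : ℕ} (d : Fin N → ℕ) : Type := (k : Fin N) → Fin (d k)

/-- Vectors of `⨂ₖ ℂ^(d k)`, given by their amplitudes in the product basis. -/
abbrev Ket {N : ℕ} (d : Fin N → ℕ) : Type := Config d → ℂ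

/-- Unit vectors, that is, pure states. -/
def IsState {N : ℕ} {d : Fin N → ℕ} (φ : Ket d) : Prop := ∑ x, ‖φ x‖ ^ 2 = 1

/-- The product state `|0⟩ ⊗ ⋯ ⊗ |0⟩`. -/
def zeroKet {N : ℕ} (d : Fin N → ℕ) : Ket d := fun x => if ∀ k, (x k).val = 0 then 1 else 0

/-- `φ` is a product vector with respect to the bipartition of the parties into `A` and its
complement. -/
def IsProductAcross {N : ℕ} {d : Fin N → ℕ} (A : Set (Fin N)) (φ : Ket d) : Prop :=
  ∃ (f : ((k : {k // k ∈ A}) → Fin (d k)) → ℂ) (g : ((k : {k // k ∉ A}) → Fin (d k)) → ℂ),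
    ∀ x, φ x = f (fun k => x k) * g (fun k => x k)

/-- Entangled with respect to every bipartition of the parties. -/
def FullyEntangled {N : ℕ} {d : Fin N → ℕ} (φ : Ket d) : Prop :=
  ∀ A : Set (Fin N), A.Nonempty → Aᶜ.Nonempty → ¬ IsProductAcross A φ

/-- The inclusion of `⨂ₖ ℂ^(t k)` into `⨂ₖ ℂ^(d k)`, where `ℂ^(t k)` is the subspace of `ℂ^(d k)`
spanned by the first `t k` basis vectors. -/
def embed {N : ℕ} {t : Fin N → ℕ} (d : Fin N → ℕ) (ψ : Ket t) : Ket d := fun x =>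
  if h : ∀ k, (x k).val < t k then ψ (fun k => ⟨x k, h k⟩) else 0

/-! ### Protocols: local measurements, classical communication, quantum communication -/

/-- The action of the operator `M` on the system of party `k`. -/
def applyLocal {N : ℕ} {d : Fin N → ℕ} (k : Fin N) (M : Matrix (Fin (d k)) (Fin (d k)) ℂ)
    (φ : Ket d) : Ket d :=
  fun x => ∑ j, M (x k) j * φ (Function.update x k j)

/-- One round of quantum communication of a `dim`-dimensional system: the systems of the sender
and of the receiver are each factorized into a `dim`-dimensional subsystem and a rest. -/
structure Communication {N : ℕ} (d : Fin N → ℕ) where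
  sender : Fin N
  receiver : Fin N
  ne : sender ≠ receiver
  dim : ℕ
  restS : ℕ
  restR : ℕ
  splitS : Fin (d sender) ≃ Fin dim × Fin restS
  splitR : Fin (d receiver) ≃ Fin dim × Fin restR

/-- The receiver's subsystem is in the state `|0⟩`. -/
def Communication.Ready {N : ℕ} {d : Fin N → ℕ} (c : Communication d) (φ : Ket d) : Prop :=
  ∀ x : Config d, (c.splitR (x c.receiver)).1.val ≠ 0 → φ x = 0

/-- Exchange of the labels of the two subsystems. -/
def Communication.exchange {N : ℕ} {d : Fin N → ℕ} (c : Communication d) (x : Config d) :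
    Config d :=
  Function.update
    (Function.update x c.sender
      (c.splitS.symm ((c.splitR (x c.receiver)).1, (c.splitS (x c.sender)).2)))
    c.receiver
    (c.splitR.symm ((c.splitS (x c.sender)).1, (c.splitR (x c.receiver)).2))

/-- The effect of the communication. It is only ever used on vectors with `c.Ready φ`: then the
receiver's subsystem takes over the state of the sender's subsystem, which is left in `|0⟩`. -/
def Communication.transmit {N : ℕ} {d : Fin N → ℕ} (c : Communication d) (φ : Ket d) : Ket d :=
  fun x => φ (c.exchange x)

/-- Finite protocols. In `measure k n M next`, party `k` performs on its system the measurement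
with Kraus operators `M 0, …, M (n-1)`, announces the outcome `j` to all parties, and the protocol
goes on with `next j`; a local unitary is the case `n = 1`. No auxiliary system is ever added. -/
inductive Protocol {N : ℕ} (d : Fin N → ℕ) : Type
  | halt : Protocol d
  | measure (k : Fin N) (n : ℕ) (M : Fin n → Matrix (Fin (d k)) (Fin (d k)) ℂ)
      (next : Fin n → Protocol d) : Protocol d
  | send (c : Communication d) (next : Protocol d) : Protocol d

/-- All local measurements of the protocol are complete: `∑ⱼ Mⱼ† Mⱼ = 1`. -/
def Protocol.IsValid {N : ℕ} {d : Fin N → ℕ} : Protocol d → Prop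
  | .halt => True
  | .measure _ _ M next => ∑ j, (M j).conjTranspose * M j = 1 ∧ ∀ j, (next j).IsValid
  | .send _ next => next.IsValid

/-- The protocol uses no quantum communication. -/
def Protocol.NoQuantumCommunication {N : ℕ} {d : Fin N → ℕ} : Protocol d → Prop
  | .halt => True
  | .measure _ _ _ next => ∀ j, (next j).NoQuantumCommunication
  | .send _ _ => False

/-- LOCC within the configuration `d`. -/
def Protocol.IsLOCC {N : ℕ} {d : Fin N → ℕ} (P : Protocol d) : Prop :=
  P.IsValid ∧ P.NoQuantumCommunication

/-- `P.Transforms φ ψ`: started in `φ`, the protocol ends in the state `ψ` in every branch of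
measurement outcomes. Vectors are not renormalized after a measurement, so that a final vector is a
multiple of `ψ`, and it is `0` exactly for a branch of probability `0`. -/
def Protocol.Transforms {N : ℕ} {d : Fin N → ℕ} : Protocol d → Ket d → Ket d → Prop
  | .halt, φ, ψ => ∃ c : ℂ, φ = c • ψ
  | .measure k _ M next, φ, ψ => ∀ j, (next j).Transforms (applyLocal k (M j) φ) ψ
  | .send c next, φ, ψ => c.Ready φ ∧ next.Transforms (c.transmit φ) ψ

/-- The resource state `φ` achieves the preparation of the target set `S` in the static setting:
`φ` can be transformed deterministically and exactly into every `ψ ∈ S` by LOCC within the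
configuration `d`. -/
def AchievesStatic {N : ℕ} {t d : Fin N → ℕ} (φ : Ket d) (S : Set (Ket t)) : Prop :=
  ∀ ψ ∈ S, ∃ P : Protocol d, P.IsLOCC ∧ P.Transforms φ (embed d ψ)

/-- The resource state `φ` achieves the preparation of `S` in the dynamic setting: the parties can
prepare `φ` from scratch by LOCC within `d` and quantum communication, and `φ` can then be
transformed into every `ψ ∈ S` by LOCC within `d`. -/
def AchievesDynamic {N : ℕ} {t d : Fin N → ℕ} (φ : Ket d) (S : Set (Ket t)) : Prop :=
  (∃ P : Protocol d, P.IsValid ∧ P.Transforms (zeroKet d) φ) ∧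
    AchievesStatic φ S

/-! ### States consisting of bipartite entanglement -/

/-- `φ` is equivalent, under local isometries `V k` into the systems of the parties, to a tensor
product `⨂ₑ |φₑ⟩` of bipartite entangled states along the edges of a graph on the parties.
For adjacent `k`, `l`, party `k` holds a system of dimension `m k l` of the state `χ k l` (`k < l`)
that it shares with `l`; for non-adjacent `k`, `l` the dimension `m k l` is `1`. -/
def ConsistsOfBipartite {N : ℕ} {d : Fin N → ℕ} (φ : Ket d) : Prop :=
  ∃ (G : SimpleGraph (Fin N)) (_ : DecidableRel G.Adj) (m : Fin N → Fin N → ℕ)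
    (χ : (k l : Fin N) → Fin (m k l) → Fin (m l k) → ℂ)
    (V : (k : Fin N) → Matrix (Fin (d k)) ((l : Fin N) → Fin (m k l)) ℂ),
    (∀ k l, ¬ G.Adj k l → m k l = 1) ∧
    (∀ k l, k < l → G.Adj k l →
      ∑ i, ∑ j, ‖χ k l i j‖ ^ 2 = 1 ∧
        ¬ ∃ (a : Fin (m k l) → ℂ) (b : Fin (m l k) → ℂ), ∀ i j, χ k l i j = a i * b j) ∧
    (∀ k, (V k).conjTranspose * V k = 1) ∧
    ∀ x, φ x = ∑ s : (k : Fin N) → (l : Fin N) → Fin (m k l),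
      (∏ k, V k (x k) (s k)) *
        ∏ e : Fin N × Fin N with e.1 < e.2 ∧ G.Adj e.1 e.2, χ e.1 e.2 (s e.1 e.2) (s e.2 e.1)

/-! ### Qubits, graph states and the circuit of the target set -/

/-- `|+⟩ ⊗ ⋯ ⊗ |+⟩` on qubits labelled by `V`. -/
def plusKet (V : Type) [Fintype V] : (V → Fin 2) → ℂ := fun _ => (1 / (√2 : ℂ)) ^ Fintype.card V

/-- The controlled-`Z` gate on the qubits `u` and `v`. -/
def cz {V : Type} (u v : V) (ψ : (V → Fin 2) → ℂ) : (V → Fin 2) → ℂ :=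
  fun b => if b u = 1 ∧ b v = 1 then -ψ b else ψ b

/-- The graph state of the graph with the listed edges. -/
def graphKet {V : Type} [Fintype V] (edges : List (V × V)) : (V → Fin 2) → ℂ :=
  edges.foldr (fun e ψ => cz e.1 e.2 ψ) (plusKet V)

/-- The eigenvalues `1`, `-1` of the Pauli operator `Z` on `|0⟩`, `|1⟩`. -/
def zSign (b : Fin 2) : ℝ := if b = 0 then 1 else -1

/-- The gate `exp(iα Z ⊗ Z)` on the qubits `u` and `v`. -/
def zzGate {V : Type} (α : ℝ) (u v : V) (ψ : (V → Fin 2) → ℂ) : (V → Fin 2) → ℂ :=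
  fun b => Complex.exp (Complex.I * (α * zSign (b u) * zSign (b v))) * ψ b

/-- The configuration of system sizes: two qubits at each of `v_1, …, v_7`, one qubit at `v_8`
(the party `v_k` has the index `k - 1`). -/
def d₀ : Fin 8 → ℕ := ![4, 4, 4, 4, 4, 4, 4, 2]

/-- The dimensions of the parts of the systems that hold the target states: one qubit each. -/
def t₀ : Fin 8 → ℕ := fun _ => 2

/-- The seven gates of the circuit act on the pairs `{v_i, parent i}`, `i = 1, …, 7`:
`{v_1, v_2}, {v_3, v_4}, {v_5, v_6}, {v_7, v_8}`, then `{v_2, v_4}, {v_6, v_8}`, then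
`{v_4, v_8}`. -/
def parent : Fin 7 → Fin 8 := ![1, 3, 3, 7, 5, 7, 7]

/-- The output `|ψ(α)⟩` of the circuit on the input `|+⟩^{⊗ 8}`. -/
def targetKet (α : Fin 7 → ℝ) : Ket t₀ :=
  (List.finRange 7).foldr (fun i ψ => zzGate (V := Fin 8) (α i) i.castSucc (parent i) ψ)
    (plusKet (Fin 8))

/-- The target set. -/
def S₀ : Set (Ket t₀) :=
  {ψ | ∃ α : Fin 7 → ℝ, (∀ i, 0 ≤ α i ∧ α i < 2 * Real.pi) ∧ ψ = targetKet α}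

/-- The values of the `15` qubits in a product basis vector: `Sum.inl k` is the target qubit of
party `k`, `Sum.inr k` is the auxiliary qubit of party `k`; a local basis label is
`target + 2 * auxiliary`. -/
def qubitValues (x : Config d₀) : Fin 8 ⊕ Fin 7 → Fin 2
  | .inl k => Fin.ofNat 2 (x k).val
  | .inr k => Fin.ofNat 2 ((x k.castSucc).val / 2)

/-- The edges of the tree on the `15` qubits: the auxiliary qubit of `v_i` is joined to the target
qubits of the two parties on which the `i`-th gate acts. -/
def resEdges : List ((Fin 8 ⊕ Fin 7) × (Fin 8 ⊕ Fin 7)) :=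
  (List.finRange 7).flatMap fun i =>
    [(Sum.inr i, Sum.inl i.castSucc), (Sum.inr i, Sum.inl (parent i))]

/-- The graph state `|Φ_res⟩` of `15` qubits, as a state of the eight parties. -/
def Φres : Ket d₀ := fun x => graphKet resEdges (qubitValues x)

/-! ### Elementary preparation protocols -/

/-- The two qubits of a party. -/
inductive Slot
  | target
  | auxiliary

def Slot.other : Slot → Slot
  | .target => .auxiliary
  | .auxiliary => .target

/-- The value of a qubit in the local basis vector with label `x = target + 2 * auxiliary`. -/
def Slot.bit : Slot → ℕ → ℕ
  | .target, x => x % 2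
  | .auxiliary, x => x / 2

/-- Initialization of a qubit of party `k` as `|+⟩`: Kraus operators `|+⟩⟨0|` and `|+⟩⟨1|`. -/
def initPlus (k : Fin 8) (s : Slot) (j : Fin 2) : Matrix (Fin (d₀ k)) (Fin (d₀ k)) ℂ :=
  Matrix.of fun y x => if s.bit x = j ∧ s.other.bit y = s.other.bit x then 1 / (√2 : ℂ) else 0

/-- The controlled-`Z` gate on the two qubits of party `k`. -/
def localCZ (k : Fin 8) : Matrix (Fin (d₀ k)) (Fin (d₀ k)) ℂ :=
  Matrix.diagonal fun x =>
    if Slot.target.bit x = 1 ∧ Slot.auxiliary.bit x = 1 then -1 else 1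

/-- The communication moves one qubit of the sender to one qubit of the receiver. -/
def Communication.IsSingleQubit (c : Communication d₀) : Prop :=
  c.dim = 2 ∧
    (∃ s : Slot, ∀ x, (c.splitS x).1.val = s.bit x ∧ (c.splitS x).2.val = s.other.bit x) ∧
    ∃ s : Slot, ∀ x, (c.splitR x).1.val = s.bit x ∧ (c.splitR x).2.val = s.other.bit x

/-- Protocols that are a fixed sequence of initializations of single qubits as `|+⟩`, `CZ` gates on
the two qubits of one party, and communications of single qubits. -/
inductive IsCZSequence : Protocol d₀ → Prop
  | halt : IsCZSequence .halt
  | initPlus (k : Fin 8) (s : Slot) (P : Protocol d₀) :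
      IsCZSequence P → IsCZSequence (.measure k 2 (initPlus k s) fun _ => P)
  | localCZ (k : Fin 8) (P : Protocol d₀) :
      IsCZSequence P → IsCZSequence (.measure k 1 (fun _ => localCZ k) fun _ => P)
  | send (c : Communication d₀) (P : Protocol d₀) :
      c.IsSingleQubit → IsCZSequence P → IsCZSequence (.send c P)

end SizeLimited

end

noncomputable section

namespace SizeLimited

/-! ### Schmidt ranks -/

/-! Negative part. LOCC cannot increase a Schmidt rank across a cut of the parties
(`SchmidtRankLE.of_transforms`), so a resource for `S₀` has, across every cut, at least the Schmidt
rank of every target state. A gate with angle `π/4` has an invertible amplitude matrix; hence one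
such gate across a cut gives rank at least two, and two across it, with disjoint pairs of ends, give
rank at least four (`two_le_schmidtRank_targetKet`, `four_le_schmidtRank_targetKet`). For bipartite
entanglement, the subsystems of party `k` have dimensions `m k l` with product at most `d k`, and
the rank across `A` is at most the product of the `m k l` with `k ∈ A`, `l ∉ A`
(`ConsistsOfBipartite.exists_dims`). The qubit of `v_8` can be entangled with only one partner `u`.
The cut around `{v_8, u}` then has rank at most `4 / 2 = 2`, which is too small unless `u = v_7`.
Likewise `v_7` has room for just one further partner `w`, and the cut around `{v_8, v_7, w}` again
has rank at most two, although two disjoint gates cross it.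

Positive part. Each auxiliary qubit of `Φres` contributes a factor `(z z') ^ a`, where `a` is its
value and `z`, `z'` are the signs of the two targets of its gate. Measuring it in a basis depending
on `α i` turns this factor into `exp(iα z z')`, up to `Z` corrections on both targets
(`sum_gateBra_mul_linkSign`, `applyLocal_gate`); no extra space is needed. For the preparation,
target qubits travel between the parties and are linked locally to auxiliary qubits that stay in
place; the correctness of the list of steps is checked by a symbolic simulation (`completes`,
`transforms_prepProtocol`). Full entanglement holds because some gate crosses every cut. -/

/-- The Schmidt rank of `φ` across the bipartition of the index set into `A` and its complement is
at most `r`. -/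
def SchmidtRankLE {ι : Type*} {S : ι → Type*} (A : Set ι) (r : ℕ) (φ : ((k : ι) → S k) → ℂ) :
    Prop :=
  ∃ f g : Fin r → ((k : ι) → S k) → ℂ, (∀ i, DependsOn (f i) A) ∧ (∀ i, DependsOn (g i) Aᶜ) ∧
    ∀ x, φ x = ∑ i, f i x * g i x

theorem SchmidtRankLE.of_fintype {ι : Type*} {S : ι → Type*} {A : Set ι}
    {φ : ((k : ι) → S k) → ℂ} {κ : Type*} [Fintype κ] (f g : κ → ((k : ι) → S k) → ℂ)
    (hf : ∀ i, DependsOn (f i) A) (hg : ∀ i, DependsOn (g i) Aᶜ)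
    (h : ∀ x, φ x = ∑ i, f i x * g i x) : SchmidtRankLE A (Fintype.card κ) φ := by
  refine ⟨fun i => f ((Fintype.equivFin κ).symm i), fun i => g ((Fintype.equivFin κ).symm i),
    fun i => hf _, fun i => hg _, fun x => ?_⟩
  rw [h x]
  exact ((Fintype.equivFin κ).symm.sum_comp fun i => f i x * g i x).symm

theorem SchmidtRankLE.compl {ι : Type*} {S : ι → Type*} {A : Set ι} {r : ℕ}
    {φ : ((k : ι) → S k) → ℂ} (h : SchmidtRankLE A r φ) : SchmidtRankLE Aᶜ r φ := by
  obtain ⟨f, g, hf, hg, h⟩ := h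
  exact ⟨g, f, hg, by simpa using hf, fun x => by simp [h x, mul_comm]⟩

theorem SchmidtRankLE.smul {ι : Type*} {S : ι → Type*} {A : Set ι} {r : ℕ}
    {φ : ((k : ι) → S k) → ℂ} (h : SchmidtRankLE A r φ) (c : ℂ) : SchmidtRankLE A r (c • φ) := by
  obtain ⟨f, g, hf, hg, h⟩ := h
  refine ⟨fun i x => c * f i x, g, fun i x y hxy => ?_, hg, fun x => ?_⟩
  · simp only [hf i hxy]
  · simp [h x, Finset.mul_sum, mul_assoc]

theorem SchmidtRankLE.comp {ι : Type*} {S T : ι → Type*} {A : Set ι} {r : ℕ}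
    {φ : ((k : ι) → S k) → ℂ} (h : SchmidtRankLE A r φ) (e : (k : ι) → T k → S k) :
    SchmidtRankLE A r fun x => φ fun k => e k (x k) := by
  obtain ⟨f, g, hf, hg, h⟩ := h
  exact ⟨fun i x => f i fun k => e k (x k), fun i x => g i fun k => e k (x k),
    fun i x y hxy => hf i fun k hk => by rw [hxy k hk],
    fun i x y hxy => hg i fun k hk => by rw [hxy k hk], fun x => h _⟩

open Classical in
/-- A nonzero minor of the amplitude matrix bounds the Schmidt rank from below. -/
theorem SchmidtRankLE.card_le {ι : Type*} {S : ι → Type*} {A : Set ι} {r : ℕ}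
    {φ : ((k : ι) → S k) → ℂ} (h : SchmidtRankLE A r φ) {n : Type*} [Fintype n] [DecidableEq n]
    (a b : n → (k : ι) → S k)
    (hdet : (Matrix.of fun i j => φ (A.piecewise (a i) (b j))).det ≠ 0) :
    Fintype.card n ≤ r := by
  obtain ⟨f, g, hf, hg, h⟩ := h
  -- The minor factors through `Fin r`, so its rank is at most `r`, whereas invertibility makes it
  -- `Fintype.card n`.
  have hM : (Matrix.of fun i j => φ (A.piecewise (a i) (b j))) =
      (Matrix.of fun i l => f l (a i)) * (Matrix.of fun l j => g l (b j)) := by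
    ext i j
    simp only [Matrix.of_apply, Matrix.mul_apply, h]
    refine Finset.sum_congr rfl fun l _ => ?_
    congr 1
    · exact hf l fun k hk => by simp [hk]
    · exact hg l fun k hk => by simp [Set.piecewise_eq_of_notMem _ _ _ hk]
  have hr := Matrix.rank_of_isUnit _ ((Matrix.isUnit_iff_isUnit_det _).2 hdet.isUnit)
  rw [hM] at hr
  calc Fintype.card n = _ := hr.symm
    _ ≤ _ := Matrix.rank_mul_le_left _ _
    _ ≤ Fintype.card (Fin r) := Matrix.rank_le_card_width _
    _ = r := Fintype.card_fin r

theorem IsProductAcross.schmidtRankLE {N : ℕ} {d : Fin N → ℕ} {A : Set (Fin N)} {φ : Ket d}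
    (h : IsProductAcross A φ) : SchmidtRankLE A 1 φ := by
  obtain ⟨f, g, h⟩ := h
  refine ⟨fun _ x => f fun k => x k, fun _ x => g fun k => x k, fun _ x y hxy => ?_,
    fun _ x y hxy => ?_, fun x => by simp [h x]⟩
  · exact congrArg f (funext fun k => hxy k k.2)
  · exact congrArg g (funext fun k => hxy k k.2)

theorem SchmidtRankLE.of_embed {N : ℕ} {t d : Fin N → ℕ} (htd : ∀ k, t k ≤ d k)
    {A : Set (Fin N)} {r : ℕ} {ψ : Ket t} (h : SchmidtRankLE A r (embed d ψ)) :
    SchmidtRankLE A r ψ := by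
  have := h.comp fun k => Fin.castLE (htd k)
  simpa [embed] using this

/-! ### Schmidt ranks do not increase under LOCC -/

theorem SchmidtRankLE.applyLocal_of_mem {N : ℕ} {d : Fin N → ℕ} {A : Set (Fin N)} {r : ℕ}
    {φ : Ket d} (h : SchmidtRankLE A r φ) {k : Fin N} (hk : k ∈ A)
    (M : Matrix (Fin (d k)) (Fin (d k)) ℂ) : SchmidtRankLE A r (applyLocal k M φ) := by
  obtain ⟨f, g, hf, hg, h⟩ := h
  refine ⟨fun i => applyLocal k M (f i), g, fun i x y hxy => ?_, hg, fun x => ?_⟩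
  · unfold applyLocal
    refine Finset.sum_congr rfl fun j _ => ?_
    rw [hxy k hk]
    congr 1
    refine hf i fun l hl => ?_
    by_cases hlk : l = k
    · subst hlk; simp
    · simp [hlk, hxy l hl]
  · simp only [applyLocal, h, Finset.mul_sum, Finset.sum_mul]
    rw [Finset.sum_comm]
    refine Finset.sum_congr rfl fun i _ => Finset.sum_congr rfl fun j _ => ?_
    have : g i (Function.update x k j) = g i x := hg i fun l hl => by
      have : l ≠ k := fun e => hl (e ▸ hk)
      simp [this]
    rw [this, mul_assoc]

theorem SchmidtRankLE.applyLocal {N : ℕ} {d : Fin N → ℕ} {A : Set (Fin N)} {r : ℕ}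
    {φ : Ket d} (h : SchmidtRankLE A r φ) (k : Fin N)
    (M : Matrix (Fin (d k)) (Fin (d k)) ℂ) : SchmidtRankLE A r (applyLocal k M φ) := by
  by_cases hk : k ∈ A
  · exact h.applyLocal_of_mem hk M
  · simpa using (h.compl.applyLocal_of_mem (k := k) hk M).compl

theorem applyLocal_applyLocal {N : ℕ} {d : Fin N → ℕ} (k : Fin N)
    (M M' : Matrix (Fin (d k)) (Fin (d k)) ℂ) (φ : Ket d) :
    applyLocal k M (applyLocal k M' φ) = applyLocal k (M * M') φ := by
  ext x
  simp only [applyLocal, Matrix.mul_apply, Function.update_self, Function.update_idem,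
    Finset.mul_sum, Finset.sum_mul]
  rw [Finset.sum_comm]
  simp only [mul_assoc]

theorem applyLocal_diagonal {N : ℕ} {d : Fin N → ℕ} (k : Fin N) (D : Fin (d k) → ℂ) (φ : Ket d)
    (x : Config d) : applyLocal k (Matrix.diagonal D) φ x = D (x k) * φ x := by
  simp [applyLocal, Matrix.diagonal_apply]

theorem applyLocal_smul {N : ℕ} {d : Fin N → ℕ} (k : Fin N)
    (M : Matrix (Fin (d k)) (Fin (d k)) ℂ) (c : ℂ) (φ : Ket d) :
    applyLocal k M (c • φ) = c • applyLocal k M φ := by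
  ext x
  simp [applyLocal, Finset.mul_sum, mul_left_comm]

/-- If all branches vanished, so would `∑ⱼ Mⱼ† Mⱼ φ`, which is `φ` by completeness. -/
theorem exists_applyLocal_ne_zero {N : ℕ} {d : Fin N → ℕ} {k : Fin N} {n : ℕ}
    {M : Fin n → Matrix (Fin (d k)) (Fin (d k)) ℂ}
    (hM : ∑ j, (M j).conjTranspose * M j = 1) {φ : Ket d} (hφ : φ ≠ 0) :
    ∃ j, applyLocal k (M j) φ ≠ 0 := by
  by_contra! h
  apply hφ
  have hz (j : Fin n) : applyLocal k ((M j).conjTranspose * M j) φ = 0 := by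
    rw [← applyLocal_applyLocal, h j]
    ext x
    simp [applyLocal]
  have hsum : applyLocal k (∑ j, (M j).conjTranspose * M j) φ = 0 := by
    ext x
    simp only [applyLocal, Matrix.sum_apply, Finset.sum_mul]
    rw [Finset.sum_comm]
    exact Finset.sum_eq_zero fun j _ => congrFun (hz j) x
  rw [hM] at hsum
  ext x
  have := congrFun hsum x
  rwa [← Matrix.diagonal_one, applyLocal_diagonal, one_mul] at this

/-- It suffices to follow one branch of nonzero probability. Nonvanishing is essential: the zero
vector is a multiple of every `ψ`, so a branch of probability zero says nothing about `ψ`. -/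
theorem SchmidtRankLE.of_transforms {N : ℕ} {d : Fin N → ℕ} {A : Set (Fin N)} {r : ℕ}
    {ψ : Ket d} (P : Protocol d) {φ : Ket d} (hP : P.IsLOCC) (hφ : φ ≠ 0)
    (h : P.Transforms φ ψ) (hr : SchmidtRankLE A r φ) : SchmidtRankLE A r ψ := by
  induction P generalizing φ with
  | halt =>
    obtain ⟨c, rfl⟩ := h
    have hc : c ≠ 0 := by rintro rfl; simp at hφ
    simpa [smul_smul, hc] using hr.smul c⁻¹
  | measure k n M next ih =>
    obtain ⟨j, hj⟩ := exists_applyLocal_ne_zero hP.1.1 hφ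
    exact ih j ⟨hP.1.2 j, hP.2 j⟩ hj (h j) (hr.applyLocal k (M j))
  | send c next _ => exact hP.2.elim

/-! ### Schmidt ranks of states consisting of bipartite entanglement -/

/-- Local operators do not increase the Schmidt rank. -/
theorem SchmidtRankLE.tensorOperator {ι : Type*} [Fintype ι] [DecidableEq ι] {S T : ι → Type*}
    [∀ k, Fintype (S k)] [∀ k, Nonempty (S k)] {A : Set ι} {r : ℕ} {φ : ((k : ι) → S k) → ℂ}
    (h : SchmidtRankLE A r φ) (V : (k : ι) → T k → S k → ℂ) :
    SchmidtRankLE A r fun x : (k : ι) → T k => ∑ s, (∏ k, V k (x k) (s k)) * φ s := by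
  classical
  obtain ⟨f, g, hf, hg, h⟩ := h
  -- An arbitrary filling: `f i` ignores the labels outside `A` and `g i` those inside, so the sum
  -- over `s` splits into a sum over each side.
  let s₀ : (k : ι) → S k := fun k => Classical.arbitrary _
  let E := Equiv.piEquivPiSubtypeProd (· ∈ A) S
  refine ⟨fun i x => ∑ a : (k : {k // k ∈ A}) → S k,
      (∏ k : {k // k ∈ A}, V k (x k) (a k)) * f i (E.symm (a, fun k => s₀ k)),
    fun i x => ∑ b : (k : {k // k ∉ A}) → S k,
      (∏ k : {k // k ∉ A}, V k (x k) (b k)) * g i (E.symm (fun k => s₀ k, b)),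
    fun i x y hxy => ?_, fun i x y hxy => ?_, fun x => ?_⟩
  · refine Finset.sum_congr rfl fun a _ => ?_
    congr 1
    exact Finset.prod_congr rfl fun k _ => by rw [hxy k k.2]
  · refine Finset.sum_congr rfl fun a _ => ?_
    congr 1
    exact Finset.prod_congr rfl fun k _ => by rw [hxy k k.2]
  · simp only [Finset.sum_mul_sum]
    rw [← E.symm.sum_comp, Fintype.sum_prod_type]
    simp only [h, Finset.mul_sum]
    conv_rhs => rw [Finset.sum_comm]
    refine Finset.sum_congr rfl fun a _ => ?_
    conv_rhs => rw [Finset.sum_comm]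
    refine Finset.sum_congr rfl fun b _ => Finset.sum_congr rfl fun i _ => ?_
    have h1 : f i (E.symm (a, b)) = f i (E.symm (a, fun k => s₀ k)) :=
      hf i fun k hk => by simp [E, Equiv.piEquivPiSubtypeProd, hk]
    have h2 : g i (E.symm (a, b)) = g i (E.symm (fun k => s₀ k, b)) :=
      hg i fun k hk => by
        have hk' : k ∉ A := hk
        simp [E, Equiv.piEquivPiSubtypeProd, hk']
    have h3 : ∏ k, V k (x k) (E.symm (a, b) k) =
        (∏ k : {k // k ∈ A}, V k (x k) (a k)) * ∏ k : {k // k ∉ A}, V k (x k) (b k) := by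
      rw [← Fintype.prod_subtype_mul_prod_subtype (· ∈ A)]
      congr 1
      · exact Finset.prod_congr rfl fun k _ => by simp [E, Equiv.piEquivPiSubtypeProd, k.2]
      · exact Finset.prod_congr rfl fun k _ => by simp [E, Equiv.piEquivPiSubtypeProd, k.2]
    rw [h1, h2, h3]
    ring

/-- A product of bipartite states has across `A` at most the Schmidt rank that the subsystems of the
cut edges on the side of `A` allow. -/
theorem schmidtRankLE_prod_edges {ι : Type*} [DecidableEq ι] [Fintype ι] (A : Finset ι)
    (m : ι → ι → ℕ) (χ : (k l : ι) → Fin (m k l) → Fin (m l k) → ℂ) (E : Finset (ι × ι)) :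
    SchmidtRankLE (S := fun k => (l : ι) → Fin (m k l)) (A : Set ι) (∏ k ∈ A, ∏ l ∈ Aᶜ, m k l)
      fun s => ∏ e ∈ E, χ e.1 e.2 (s e.1 e.2) (s e.2 e.1) := by
  classical
  -- The sum runs over all values `c` of the subsystems held in `A` and facing `Aᶜ`. The left factor
  -- tests whether `s` has these values. The right factor reads them from `c` instead of `s`, and
  -- thereby depends on `Aᶜ` only, even for the cut edges.
  let κ : Type _ := (p : A × (Aᶜ : Finset ι)) → Fin (m p.1 p.2)
  have hcard : Fintype.card κ = ∏ k ∈ A, ∏ l ∈ Aᶜ, m k l := by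
    simp only [κ, Fintype.card_pi, Fintype.card_fin, Fintype.prod_prod_type]
    rw [← Finset.prod_coe_sort A]
    exact Finset.prod_congr rfl fun k _ => Finset.prod_coe_sort (Aᶜ) fun l => m k l
  let val (c : κ) (s : (k l : ι) → Fin (m k l)) (k l : ι) : Fin (m k l) :=
    if h : k ∈ A ∧ l ∈ Aᶜ then c (⟨k, h.1⟩, ⟨l, h.2⟩) else s k l
  rw [← hcard]
  refine .of_fintype
    (fun c s => if (fun p : A × (Aᶜ : Finset ι) => s p.1 p.2) = c then
      ∏ e ∈ E with e.1 ∈ A ∧ e.2 ∈ A, χ e.1 e.2 (s e.1 e.2) (s e.2 e.1) else 0)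
    (fun c s => ∏ e ∈ E with ¬ (e.1 ∈ A ∧ e.2 ∈ A),
      χ e.1 e.2 (val c s e.1 e.2) (val c s e.2 e.1))
    (fun c s s' hs => ?_) (fun c s s' hs => ?_) fun s => ?_
  · have h1 : (fun p : A × (Aᶜ : Finset ι) => s p.1 p.2) =
        fun p : A × (Aᶜ : Finset ι) => s' p.1 p.2 :=
      funext fun p => congrFun (hs p.1 p.1.2) _
    simp only [h1]
    congr 1
    refine Finset.prod_congr rfl fun e he => ?_
    simp only [Finset.mem_filter] at he
    rw [hs e.1 he.2.1, hs e.2 he.2.2]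
  · refine Finset.prod_congr rfl fun e he => ?_
    simp only [Finset.mem_filter] at he
    have key (k l : ι) (h : ¬ (k ∈ A ∧ l ∈ A)) : val c s k l = val c s' k l := by
      simp only [val]
      split_ifs with h'
      · rfl
      · exact congrFun (hs k fun hk : k ∈ A => h' ⟨hk, by simpa using fun hl => h ⟨hk, hl⟩⟩) l
    rw [key _ _ he.2, key _ _ fun h => he.2 h.symm]
  · rw [Fintype.sum_eq_single (fun p : A × (Aᶜ : Finset ι) => s p.1 p.2)
      fun c hc => by rw [if_neg hc.symm, zero_mul], if_pos rfl]
    rw [← Finset.prod_filter_mul_prod_filter_not E fun e => e.1 ∈ A ∧ e.2 ∈ A]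
    congr 1
    refine Finset.prod_congr rfl fun e _ => ?_
    have key (k l : ι) :
        val (fun p : A × (Aᶜ : Finset ι) => s p.1 p.2) s k l = s k l := by
      simp only [val]
      split_ifs <;> rfl
    rw [key, key]

theorem card_le_of_conjTranspose_mul_self {a b : Type*} [Fintype a] [Fintype b] [DecidableEq b]
    (V : Matrix a b ℂ) (hV : V.conjTranspose * V = 1) : Fintype.card b ≤ Fintype.card a := by
  have h := Matrix.rank_one (R := ℂ) (n := b)
  rw [← hV] at h
  rw [← h]
  exact (Matrix.rank_mul_le_right _ _).trans (Matrix.rank_le_card_height _)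

/-- The dimensions of the shared subsystems of a state consisting of bipartite entanglement, and
the Schmidt ranks that they allow. -/
theorem ConsistsOfBipartite.exists_dims {N : ℕ} {d : Fin N → ℕ} {φ : Ket d}
    (h : ConsistsOfBipartite φ) :
    ∃ m : Fin N → Fin N → ℕ, (∀ k l, 1 ≤ m k l) ∧ (∀ k l, 2 ≤ m k l → 2 ≤ m l k) ∧
      (∀ k, ∏ l, m k l ≤ d k) ∧
      ∀ A : Finset (Fin N), SchmidtRankLE (A : Set (Fin N)) (∏ k ∈ A, ∏ l ∈ Aᶜ, m k l) φ := by
  obtain ⟨G, _, m, χ, V, hm, hχ, hV, hφ⟩ := h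
  have hlt (k l : Fin N) (hkl : k < l) (hadj : G.Adj k l) : 2 ≤ m k l ∧ 2 ≤ m l k := by
    have hne := (hχ k l hkl hadj).2
    constructor
    · by_contra! hlt
      -- With at most one label on one side, `χ k l` is a product vector, contrary to the
      -- entanglement of the edge.
      have : Subsingleton (Fin (m k l)) := Fin.subsingleton_iff_le_one.2 (by omega)
      refine hne ⟨fun _ => 1, fun j => ∑ i, χ k l i j, fun i j => ?_⟩
      simp [Fintype.sum_subsingleton _ i]
    · by_contra! hlt
      have : Subsingleton (Fin (m l k)) := Fin.subsingleton_iff_le_one.2 (by omega)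
      refine hne ⟨fun i => ∑ j, χ k l i j, fun _ => 1, fun i j => ?_⟩
      simp [Fintype.sum_subsingleton _ j]
  have hadj (k l : Fin N) (h : G.Adj k l) : 2 ≤ m k l := by
    rcases lt_or_gt_of_ne h.ne with hkl | hkl
    · exact (hlt k l hkl h).1
    · exact (hlt l k hkl h.symm).2
  have hpos (k l : Fin N) : 1 ≤ m k l := by
    by_cases h : G.Adj k l
    · exact (hadj k l h).trans' one_le_two
    · exact (hm k l h).ge
  refine ⟨m, hpos, fun k l hkl => ?_, fun k => ?_, fun A => ?_⟩
  · by_contra hlk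
    have : ¬ G.Adj k l := fun h => hlk (hadj l k h.symm)
    simp [hm k l this] at hkl
  · simpa [Fintype.card_pi] using card_le_of_conjTranspose_mul_self (V k) (hV k)
  · have (k : Fin N) : Nonempty ((l : Fin N) → Fin (m k l)) := ⟨fun l => ⟨0, hpos k l⟩⟩
    have := (schmidtRankLE_prod_edges A m χ
      (Finset.univ.filter fun e => e.1 < e.2 ∧ G.Adj e.1 e.2)).tensorOperator
      (T := fun k => Fin (d k)) V
    convert this using 1
    exact funext hφ


/-! ### Schmidt ranks of the target states -/

theorem foldr_zzGate {V : Type} (α : Fin 7 → ℝ) (u v : Fin 7 → V) (L : List (Fin 7))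
    (ψ : (V → Fin 2) → ℂ) (b : V → Fin 2) :
    L.foldr (fun i ψ => zzGate (α i) (u i) (v i) ψ) ψ b =
      (L.map fun i => Complex.exp (Complex.I * (α i * zSign (b (u i)) * zSign (b (v i))))).prod *
        ψ b := by
  induction L with
  | nil => simp
  | cons i L ih => simp [zzGate, ih, mul_assoc]

theorem targetKet_apply (α : Fin 7 → ℝ) (b : Fin 8 → Fin 2) :
    targetKet α b = (1 / (√2 : ℂ)) ^ 8 *
      ∏ i, Complex.exp (Complex.I * (α i * zSign (b i.castSucc) * zSign (b (parent i)))) := by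
  have := foldr_zzGate α Fin.castSucc parent (List.finRange 7) (plusKet (Fin 8)) b
  rw [← List.ofFn_eq_map, List.prod_ofFn] at this
  exact this.trans (by simp [plusKet, mul_comm])

/-- The two qubits on which the `i`-th gate acts, in one of the two orders. -/
def gateEnds (i : Fin 7) (o : Bool) : Fin 8 × Fin 8 :=
  if o then (i.castSucc, parent i) else (parent i, i.castSucc)

/-- The matrix of the amplitudes of `exp(iπ/4 Z ⊗ Z)`. -/
def zzMatrix : Matrix (Fin 2) (Fin 2) ℂ :=
  Matrix.of fun p q => Complex.exp (Complex.I * ((Real.pi / 4 : ℝ) * zSign p * zSign q))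

theorem det_zzMatrix_ne_zero : zzMatrix.det ≠ 0 := by
  have h : zzMatrix.det = 2 * Complex.I := by
    simp only [Matrix.det_fin_two, zzMatrix, Matrix.of_apply, zSign, ← Complex.exp_add]
    have e1 : Complex.I * (((Real.pi / 4 : ℝ) : ℂ) * ((1 : ℝ) : ℂ) * ((1 : ℝ) : ℂ)) +
        Complex.I * (((Real.pi / 4 : ℝ) : ℂ) * ((-1 : ℝ) : ℂ) * ((-1 : ℝ) : ℂ)) =
          (Real.pi : ℂ) / 2 * Complex.I := by push_cast; ring
    have e2 : Complex.I * (((Real.pi / 4 : ℝ) : ℂ) * ((1 : ℝ) : ℂ) * ((-1 : ℝ) : ℂ)) +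
        Complex.I * (((Real.pi / 4 : ℝ) : ℂ) * ((-1 : ℝ) : ℂ) * ((1 : ℝ) : ℂ)) =
          -((Real.pi : ℂ) / 2 * Complex.I) := by push_cast; ring
    simp only [if_true, one_ne_zero, if_false, e1, e2, Complex.exp_neg,
      Complex.exp_pi_div_two_mul_I, Complex.inv_I]
    ring
  rw [h]
  simp

theorem exp_zSign_gateEnds (i : Fin 7) (o : Bool) (θ : ℝ) (b : Fin 8 → Fin 2) :
    Complex.exp (Complex.I * (θ * zSign (b i.castSucc) * zSign (b (parent i)))) =
      Complex.exp (Complex.I *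
        (θ * zSign (b (gateEnds i o).1) * zSign (b (gateEnds i o).2))) := by
  cases o
  · simp [gateEnds, mul_right_comm]
  · simp [gateEnds]

/-- The angles with the value `π/4` at the gates in `I` and `0` at the others. -/
def quarterAngles (I : Finset (Fin 7)) (i : Fin 7) : ℝ := if i ∈ I then Real.pi / 4 else 0

theorem targetKet_quarterAngles_mem (I : Finset (Fin 7)) : targetKet (quarterAngles I) ∈ S₀ := by
  refine ⟨_, fun i => ?_, rfl⟩
  have := Real.pi_pos
  unfold quarterAngles
  split_ifs <;> constructor <;> linarith

theorem targetKet_quarterAngles (I : Finset (Fin 7)) (o : Fin 7 → Bool) (b : Fin 8 → Fin 2) :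
    targetKet (quarterAngles I) b = (1 / (√2 : ℂ)) ^ 8 *
      ∏ i ∈ I, zzMatrix (b (gateEnds i (o i)).1) (b (gateEnds i (o i)).2) := by
  rw [targetKet_apply, ← Finset.prod_subset (Finset.subset_univ I)]
  · congr 1
    refine Finset.prod_congr rfl fun i hi => ?_
    rw [exp_zSign_gateEnds i (o i)]
    simp [quarterAngles, hi, zzMatrix]
  · intro i _ hi
    simp [quarterAngles, hi]

/-- The orientation `o` puts the end of each gate that lies in `A` first, so that minors of the
amplitudes appear as `zzMatrix` and not its transpose. -/
theorem SchmidtRankLE.of_quarterAngles {A : Set (Fin 8)} {r : ℕ} {I : Finset (Fin 7)}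
    (h : SchmidtRankLE A r (targetKet (quarterAngles I))) (o : Fin 7 → Bool) :
    SchmidtRankLE (S := fun _ : Fin 8 => Fin 2) A r fun b => (1 / (√2 : ℂ)) ^ 8 *
      ∏ i ∈ I, zzMatrix (b (gateEnds i (o i)).1) (b (gateEnds i (o i)).2) := by
  have e := funext (targetKet_quarterAngles I o)
  exact e ▸ h

theorem one_div_sqrt_two_pow_ne_zero (n : ℕ) : (1 / (√2 : ℂ)) ^ n ≠ 0 := by
  simp

open Classical in
/-- A single gate across a cut creates Schmidt rank two. -/
theorem two_le_schmidtRank_targetKet {A : Set (Fin 8)} {i : Fin 7} {o : Bool}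
    (h1 : (gateEnds i o).1 ∈ A) (h2 : (gateEnds i o).2 ∉ A) {r : ℕ}
    (h : SchmidtRankLE A r (targetKet (quarterAngles {i}))) : 2 ≤ r := by
  -- All qubits in `A` take the value `p`, all others `q`; as only gate `i` is switched on, the
  -- minor is a multiple of `zzMatrix`.
  have := (h.of_quarterAngles fun _ => o).card_le (n := Fin 2) (fun p _ => p) (fun q _ => q) ?_
  · simpa using this
  · have e : (Matrix.of fun p q : Fin 2 => (1 / (√2 : ℂ)) ^ 8 * ∏ i ∈ {i},
        zzMatrix (A.piecewise (fun _ => p) (fun _ => q) (gateEnds i o).1)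
          (A.piecewise (fun _ => p) (fun _ => q) (gateEnds i o).2)) =
        (1 / (√2 : ℂ)) ^ 8 • zzMatrix := by
      ext p q
      simp [h1, h2]
    rw [e, Matrix.det_smul]
    exact mul_ne_zero (pow_ne_zero _ (one_div_sqrt_two_pow_ne_zero 8)) det_zzMatrix_ne_zero

open Classical in
/-- Two gates on disjoint pairs across a cut create Schmidt rank four. -/
theorem four_le_schmidtRank_targetKet {A : Set (Fin 8)} {i j : Fin 7} {o o' : Bool} (hij : i ≠ j)
    (hi₁ : (gateEnds i o).1 ∈ A) (hi₂ : (gateEnds i o).2 ∉ A)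
    (hj₁ : (gateEnds j o').1 ∈ A) (hj₂ : (gateEnds j o').2 ∉ A)
    (h₁ : (gateEnds i o).1 ≠ (gateEnds j o').1) (h₂ : (gateEnds i o).2 ≠ (gateEnds j o').2) {r : ℕ}
    (h : SchmidtRankLE A r (targetKet (quarterAngles {i, j}))) : 4 ≤ r := by
  -- On each side one bit sits on the end of gate `i` and the other bit on all remaining qubits,
  -- among them the end of gate `j`. The minor is then a multiple of `zzMatrix ⊗ zzMatrix`.
  have := (h.of_quarterAngles fun k => if k = i then o else o').card_le (n := Fin 2 × Fin 2)
    (fun p k => if k = (gateEnds i o).1 then p.1 else p.2)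
    (fun q k => if k = (gateEnds i o).2 then q.1 else q.2) ?_
  · simpa using this
  · rw [show (Matrix.of _) = (1 / (√2 : ℂ)) ^ 8 • Matrix.kroneckerMap (· * ·) zzMatrix zzMatrix by
      ext p q
      simp [Finset.prod_pair hij, hij.symm, hi₁, hi₂, hj₁, hj₂, h₁.symm, h₂.symm],
      Matrix.det_smul, Matrix.det_kronecker]
    exact mul_ne_zero (pow_ne_zero _ (one_div_sqrt_two_pow_ne_zero 8))
      (mul_ne_zero (pow_ne_zero _ det_zzMatrix_ne_zero) (pow_ne_zero _ det_zzMatrix_ne_zero))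

/-! ### Bipartite entanglement does not suffice -/

/-- The Schmidt rank of the target states bounds that of a resource state from below. -/
theorem AchievesStatic.schmidtRankLE {φ : Ket d₀} (h : AchievesStatic φ S₀) (hφ : IsState φ)
    {A : Set (Fin 8)} {r : ℕ} (hr : SchmidtRankLE A r φ) (I : Finset (Fin 7)) :
    SchmidtRankLE A r (targetKet (quarterAngles I)) := by
  obtain ⟨P, hP, hT⟩ := h _ (targetKet_quarterAngles_mem I)
  have hne : φ ≠ 0 := by
    rintro rfl
    simp [IsState] at hφ
  exact (hr.of_transforms P hP hne hT).of_embed (by decide)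

theorem two_mul_prod_le {N : ℕ} {m : Fin N → ℕ} {d : ℕ} (hm : ∀ l, 1 ≤ m l) (hd : ∏ l, m l ≤ d)
    {b : Fin N} (hb : 2 ≤ m b) {T : Finset (Fin N)} (hT : b ∉ T) : 2 * ∏ l ∈ T, m l ≤ d :=
  calc 2 * ∏ l ∈ T, m l ≤ m b * ∏ l ∈ T, m l := Nat.mul_le_mul_right _ hb
    _ = ∏ l ∈ insert b T, m l := (Finset.prod_insert hT).symm
    _ ≤ ∏ l, m l := Finset.prod_le_prod_of_subset_of_one_le' (Finset.subset_univ _)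
        fun l _ _ => hm l
    _ ≤ d := hd

theorem exists_two_le_of_prod {N : ℕ} {m : Fin N → ℕ} (hm : ∀ l, 1 ≤ m l) {T : Finset (Fin N)}
    (hT : 2 ≤ ∏ l ∈ T, m l) : ∃ l ∈ T, 2 ≤ m l := by
  by_contra! h
  have : ∏ l ∈ T, m l = 1 := Finset.prod_eq_one fun l hl => by
    have := hm l; have := h l hl; omega
  omega

/-- The party `v_7` (index 6) is excluded because it is a leaf attached to `v_8`: all gates leaving
`{v_8, v_7}` share the end `v_8`. -/
theorem exists_gates_across_pair : ∀ u : Fin 8, u ≠ 7 → u ≠ 6 → ∃ (i j : Fin 7) (o o' : Bool),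
    i ≠ j ∧ (gateEnds i o).1 ∈ ({7, u} : Finset (Fin 8)) ∧
    (gateEnds i o).2 ∉ ({7, u} : Finset (Fin 8)) ∧ (gateEnds j o').1 ∈ ({7, u} : Finset (Fin 8)) ∧
    (gateEnds j o').2 ∉ ({7, u} : Finset (Fin 8)) ∧ (gateEnds i o).1 ≠ (gateEnds j o').1 ∧
    (gateEnds i o).2 ≠ (gateEnds j o').2 := by
  decide

/-- One gate joins `v_8` to whichever of `v_4`, `v_6` is suitable, the other joins `w` to a
different party outside. -/
theorem exists_gates_across_triple : ∀ w : Fin 8, w ≠ 7 → w ≠ 6 → ∃ (i j : Fin 7) (o o' : Bool),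
    i ≠ j ∧ (gateEnds i o).1 ∈ ({7, 6, w} : Finset (Fin 8)) ∧
    (gateEnds i o).2 ∉ ({7, 6, w} : Finset (Fin 8)) ∧
    (gateEnds j o').1 ∈ ({7, 6, w} : Finset (Fin 8)) ∧
    (gateEnds j o').2 ∉ ({7, 6, w} : Finset (Fin 8)) ∧ (gateEnds i o).1 ≠ (gateEnds j o').1 ∧
    (gateEnds i o).2 ≠ (gateEnds j o').2 := by
  decide

/-- The size limits force the graph of a resource of bipartite entanglement to be a path that starts
at `v_8`, and one of the first three cuts along such a path has too small a Schmidt rank. -/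
theorem not_achievesStatic_of_consistsOfBipartite {φ : Ket d₀} (hφ : IsState φ)
    (hb : ConsistsOfBipartite φ) : ¬ AchievesStatic φ S₀ := by
  intro h
  obtain ⟨m, hm, hsymm, hd, hrank⟩ := hb.exists_dims
  have hd4 (k : Fin 8) : ∏ l, m k l ≤ 4 := (hd k).trans ((by decide : ∀ k, d₀ k ≤ 4) k)
  have hd7 : ∏ l, m 7 l ≤ 2 := hd 7
  -- The cut around `v_8` forces a partner `u`, which exhausts the dimension 2 of `v_8` (`p7`) and
  -- leaves at most `4 / 2` at `u` (`pu`).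
  have c1 := two_le_schmidtRank_targetKet (i := 6) (o := false) (by decide) (by decide)
    (h.schmidtRankLE hφ (hrank {7}) {6})
  rw [Finset.prod_singleton] at c1
  obtain ⟨u, hu, h7u⟩ := exists_two_le_of_prod (hm 7) c1
  have hu7 : u ≠ 7 := by simpa using hu
  have hu7' := hsymm 7 u h7u
  have p7 {T : Finset (Fin 8)} (hT : u ∉ T) : ∏ l ∈ T, m 7 l ≤ 1 := by
    have := two_mul_prod_le (hm 7) hd7 h7u hT; omega
  have pu {T : Finset (Fin 8)} (hT : 7 ∉ T) : ∏ l ∈ T, m u l ≤ 2 := by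
    have := two_mul_prod_le (hm u) (hd4 u) hu7' hT; omega
  obtain rfl : u = 6 := by
    by_contra hu6
    obtain ⟨i, j, o, o', hij, h1, h2, h3, h4, h5, h6⟩ := exists_gates_across_pair u hu7 hu6
    have c2 := four_le_schmidtRank_targetKet hij (by exact_mod_cast h1) (by exact_mod_cast h2)
      (by exact_mod_cast h3) (by exact_mod_cast h4) h5 h6 (h.schmidtRankLE hφ (hrank {7, u}) {i, j})
    rw [Finset.prod_pair hu7.symm] at c2
    have := Nat.mul_le_mul (p7 (T := {7, u}ᶜ) (by simp)) (pu (T := {7, u}ᶜ) (by simp))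
    omega
  -- The gate on `v_6 v_8` crosses the cut around `{v_8, v_7}`; since `v_8` is exhausted, `v_7` must
  -- have a further partner `w`.
  have c3 := two_le_schmidtRank_targetKet (i := 5) (o := false) (by simp [gateEnds, parent])
    (by simp [gateEnds]) (h.schmidtRankLE hφ (hrank {7, 6}) {5})
  rw [Finset.prod_pair hu7.symm] at c3
  have c3' : 2 ≤ ∏ l ∈ ({7, 6}ᶜ : Finset (Fin 8)), m 6 l := by
    have := Nat.mul_le_mul_right (∏ l ∈ ({7, 6}ᶜ : Finset (Fin 8)), m 6 l)
      (p7 (T := {7, 6}ᶜ) (by simp))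
    omega
  obtain ⟨w, hw, h6w⟩ := exists_two_le_of_prod (hm 6) c3'
  have hw7 : w ≠ 7 ∧ w ≠ 6 := by simpa using hw
  obtain ⟨i, j, o, o', hij, h1, h2, h3, h4, h5, h6⟩ :=
    exists_gates_across_triple w hw7.1 hw7.2
  have c4 := four_le_schmidtRank_targetKet hij (by exact_mod_cast h1) (by exact_mod_cast h2)
    (by exact_mod_cast h3) (by exact_mod_cast h4) h5 h6
    (h.schmidtRankLE hφ (hrank {7, 6, w}) {i, j})
  rw [Finset.prod_insert (by simp [hw7.1.symm]), Finset.prod_pair hw7.2.symm] at c4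
  have q7 := p7 (T := {7, 6, w}ᶜ) (by simp)
  -- The dimension 4 of `v_7` is used up by its shares with `v_8` and with `w`.
  have q6 : ∏ l ∈ ({7, 6, w}ᶜ : Finset (Fin 8)), m 6 l ≤ 1 := by
    have := pu (T := insert w {7, 6, w}ᶜ) (by simp [hw7.1.symm])
    rw [Finset.prod_insert (by simp)] at this
    nlinarith
  have qw : ∏ l ∈ ({7, 6, w}ᶜ : Finset (Fin 8)), m w l ≤ 2 := by
    have := two_mul_prod_le (hm w) (hd4 w) (hsymm 6 w h6w)
      (T := {7, 6, w}ᶜ) (by simp)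
    omega
  have := Nat.mul_le_mul q7 (Nat.mul_le_mul q6 qw)
  omega


/-! ### Kets of the fifteen qubits -/

/-- The labels of the fifteen qubits. -/
abbrev Qubit : Type := Fin 8 ⊕ Fin 7

/-- A ket of fifteen qubits as a ket of the eight parties. -/
def lift (ψ : (Qubit → Fin 2) → ℂ) : Ket d₀ := fun x => ψ (qubitValues x)

theorem d₀_eq_mul : ∀ k : Fin 8, d₀ k = d₀ k / 2 * 2 := by decide

theorem d₀_castSucc : ∀ i : Fin 7, d₀ i.castSucc = 4 := by decide

theorem lt_four (k : Fin 8) (y : Fin (d₀ k)) : y.val < 4 :=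
  y.2.trans_le ((by decide : ∀ k, d₀ k ≤ 4) k)

theorem qubitValues_inl (x : Config d₀) (k : Fin 8) :
    qubitValues x (.inl k) = Fin.ofNat 2 (x k).val := rfl

theorem qubitValues_inr (x : Config d₀) (i : Fin 7) :
    qubitValues x (.inr i) = Fin.ofNat 2 ((x i.castSucc).val / 2) := rfl

theorem qubitValues_update_target (x : Config d₀) (k : Fin 8) (y : Fin (d₀ k))
    (h : y.val / 2 = (x k).val / 2) :
    qubitValues (Function.update x k y) =
      Function.update (qubitValues x) (.inl k) (Fin.ofNat 2 y.val) := by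
  ext q : 1
  rcases q with l | i
  · by_cases hl : l = k
    · subst hl; simp [qubitValues_inl]
    · simp [qubitValues_inl, hl]
  · by_cases hi : i.castSucc = k
    · subst hi; simp [qubitValues_inr, h]
    · simp [qubitValues_inr, hi]

theorem qubitValues_update_aux (x : Config d₀) (i : Fin 7) (y : Fin (d₀ i.castSucc))
    (h : y.val % 2 = (x i.castSucc).val % 2) :
    qubitValues (Function.update x i.castSucc y) =
      Function.update (qubitValues x) (.inr i) (Fin.ofNat 2 (y.val / 2)) := by
  ext q : 1
  rcases q with l | j
  · by_cases hl : l = i.castSucc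
    · subst hl; simp [qubitValues_inl, Fin.ext_iff, h]
    · simp [qubitValues_inl, hl]
  · by_cases hj : j = i
    · subst hj; simp [qubitValues_inr]
    · simp [qubitValues_inr, hj]

/-- The label of the local basis vector of `v_i` with the given values of the two qubits. -/
def localLabel (i : Fin 7) (t a : Fin 2) : Fin (d₀ i.castSucc) :=
  ⟨t.val + 2 * a.val, by rw [d₀_castSucc]; omega⟩

theorem sum_localLabel (i : Fin 7) (f : Fin (d₀ i.castSucc) → ℂ) :
    ∑ y, f y = ∑ a, ∑ t, f (localLabel i t a) := by
  rw [← (finProdFinEquiv.trans (finCongr (d₀_castSucc i).symm) :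
    (Fin 2 × Fin 2) ≃ Fin (d₀ i.castSucc)).sum_comp, Fintype.sum_prod_type]
  rfl

theorem qubitValues_update_localLabel (x : Config d₀) (i : Fin 7) (a : Fin 2) :
    qubitValues (Function.update x i.castSucc
      (localLabel i (qubitValues x (.inl i.castSucc)) a)) =
      Function.update (qubitValues x) (.inr i) a := by
  rw [qubitValues_update_aux]
  · congr 1
    ext
    simp [localLabel]
    omega
  · simp [localLabel, qubitValues_inl]

theorem norm_one_div_sqrt_two_pow (n : ℕ) : ‖(1 / (√2 : ℂ)) ^ n‖ ^ 2 = (1 / 2 : ℝ) ^ n := by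
  rw [norm_pow, norm_div, norm_one, Complex.norm_real, Real.norm_of_nonneg (Real.sqrt_nonneg 2),
    ← pow_mul, mul_comm n 2, pow_mul, div_pow, one_pow, Real.sq_sqrt two_pos.le]

/-- The sign of the amplitudes of a graph state. -/
def graphSign {V : Type} (E : List (V × V)) (b : V → Fin 2) : ℂ :=
  (E.map fun e => if b e.1 = 1 ∧ b e.2 = 1 then (-1 : ℂ) else 1).prod

theorem graphKet_apply {V : Type} [Fintype V] (E : List (V × V)) (b : V → Fin 2) :
    graphKet E b = (1 / (√2 : ℂ)) ^ Fintype.card V * graphSign E b := by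
  unfold graphKet graphSign
  induction E with
  | nil => simp [plusKet]
  | cons e E ih =>
    rw [List.foldr_cons, cz, ih, List.map_cons, List.prod_cons]
    split_ifs <;> ring

theorem Φres_eq : Φres = (1 / (√2 : ℂ)) ^ 15 • lift (graphSign resEdges) := by
  ext x
  rw [Φres, graphKet_apply]
  rfl

theorem norm_graphSign {V : Type} (E : List (V × V)) (b : V → Fin 2) : ‖graphSign E b‖ = 1 := by
  unfold graphSign
  induction E with
  | nil => simp
  | cons e E ih =>
    rw [List.map_cons, List.prod_cons, norm_mul, ih]
    split_ifs <;> simp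

theorem isState_Φres : IsState Φres := by
  have h (x : Config d₀) : ‖Φres x‖ ^ 2 = (1 / 2 : ℝ) ^ 15 := by
    rw [Φres_eq, Pi.smul_apply, smul_eq_mul, norm_mul, lift, norm_graphSign, mul_one,
      norm_one_div_sqrt_two_pow]
  have hc : Fintype.card (Config d₀) = 2 ^ 15 := by
    rw [Fintype.card_pi]
    simp only [Fintype.card_fin]
    decide
  simp only [IsState, h, Finset.sum_const, Finset.card_univ, hc]
  norm_num

/-- The sign of the edges at an auxiliary qubit with value `a`, for the values `t` and `t'` of its
neighbours. -/
def linkSign (a t t' : Fin 2) : ℂ := (zSign t * zSign t' : ℝ) ^ a.val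

/-- Grouping the edges by their auxiliary end makes `Φres` a product over the gates, the form in
which its entanglement and its transformations are computed. -/
theorem graphSign_resEdges (b : Qubit → Fin 2) :
    graphSign resEdges b =
      ∏ i : Fin 7, linkSign (b (.inr i)) (b (.inl i.castSucc)) (b (.inl (parent i))) := by
  have h (L : List (Fin 7)) : graphSign (L.flatMap fun i =>
      [((Sum.inr i, Sum.inl i.castSucc) : Qubit × Qubit), (Sum.inr i, Sum.inl (parent i))]) b =
      (L.map fun i =>
        linkSign (b (.inr i)) (b (.inl i.castSucc)) (b (.inl (parent i)))).prod := by
    induction L with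
    | nil => simp [graphSign]
    | cons i L ih =>
      rw [List.map_cons, List.prod_cons, ← ih]
      simp only [graphSign, List.flatMap_cons, List.cons_append, List.nil_append, List.map_cons,
        List.prod_cons, ← mul_assoc]
      congr 1
      generalize b (.inr i) = a
      generalize b (.inl i.castSucc) = t
      generalize b (.inl (parent i)) = t'
      fin_cases a <;> fin_cases t <;> fin_cases t' <;> simp [linkSign, zSign]
  rw [resEdges, h, ← List.ofFn_eq_map, List.prod_ofFn]

/-! ### Full entanglement -/

/-- The gates form a connected tree rooted at `v_8`, so a set that no gate leaves contains all
parties or none. -/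
theorem exists_gate_across (A : Set (Fin 8)) (hA : A.Nonempty) (hA' : Aᶜ.Nonempty) :
    ∃ i : Fin 7, ¬ (i.castSucc ∈ A ↔ parent i ∈ A) := by
  by_contra! h
  have key : ∀ k : Fin 8, k ∈ A ↔ (7 : Fin 8) ∈ A := by
    have h0 : (0 : Fin 8) ∈ A ↔ (1 : Fin 8) ∈ A := h 0
    have h1 : (1 : Fin 8) ∈ A ↔ (3 : Fin 8) ∈ A := h 1
    have h2 : (2 : Fin 8) ∈ A ↔ (3 : Fin 8) ∈ A := h 2
    have h3 : (3 : Fin 8) ∈ A ↔ (7 : Fin 8) ∈ A := h 3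
    have h4 : (4 : Fin 8) ∈ A ↔ (5 : Fin 8) ∈ A := h 4
    have h5 : (5 : Fin 8) ∈ A ↔ (7 : Fin 8) ∈ A := h 5
    have h6 : (6 : Fin 8) ∈ A ↔ (7 : Fin 8) ∈ A := h 6
    intro k
    fin_cases k <;> simp <;> tauto
  obtain ⟨a, ha⟩ := hA
  obtain ⟨b, hb⟩ := hA'
  exact hb ((key b).2 ((key a).1 ha))

open Classical in
theorem fullyEntangled_Φres : FullyEntangled Φres := by
  intro A hA hA' hprod
  obtain ⟨i, hi⟩ := exists_gate_across A hA hA'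
  wlog hiA : i.castSucc ∈ A generalizing A
  · refine this Aᶜ hA' (by simpa using hA) ?_ (by simpa [not_iff_not] using hi) hiA
    obtain ⟨f, g, h⟩ := hprod
    refine ⟨g, fun y => f fun k => y ⟨k, fun hk => hk k.2⟩, fun x => ?_⟩
    rw [h x, mul_comm]
    rfl
  have hpA : parent i ∉ A := fun h => hi ⟨fun _ => h, fun _ => hiA⟩
  have hne : parent i ≠ i.castSucc := fun h => hpA (h ▸ hiA)
  -- Only the auxiliary qubit of `v_i` (value `p`) and the target of its parent (value `q`) vary.
  -- They are joined by an edge across the cut, so the minor is a multiple of `(-1) ^ (p q)`. The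
  -- remainder modulo `d₀ k` only makes the label well-typed.
  let a (p : Fin 2) : Config d₀ := fun k =>
    if k = i.castSucc then ⟨2 * p.val % d₀ k, Nat.mod_lt _ ((by decide : ∀ k, 0 < d₀ k) k)⟩
    else ⟨0, (by decide : ∀ k, 0 < d₀ k) k⟩
  let b (p : Fin 2) : Config d₀ := fun k =>
    if k = parent i then ⟨p.val, p.2.trans_le ((by decide : ∀ k, 2 ≤ d₀ k) k)⟩
    else ⟨0, (by decide : ∀ k, 0 < d₀ k) k⟩
  have := hprod.schmidtRankLE.card_le (n := Fin 2) a b ?_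
  · simp at this
  · have hq (p q : Fin 2) : qubitValues (A.piecewise (a p) (b q)) =
        Function.update (Function.update (fun _ => 0) (.inr i) p) (.inl (parent i)) q := by
      ext r : 1
      rcases r with l | j
      · rw [qubitValues_inl]
        by_cases hl : l = parent i
        · subst hl
          simp [hpA, b]
        · by_cases hlA : l ∈ A
          · by_cases hli : l = i.castSucc
            · subst hli
              simp [hlA, a, hl, d₀_castSucc, Fin.ext_iff]
            · simp [hlA, a, hl, hli]
          · simp [hlA, b, hl]
      · rw [qubitValues_inr]
        by_cases hj : j = i
        · subst hj
          simp [hiA, a, d₀_castSucc, Fin.ext_iff]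
          omega
        · by_cases hlA : j.castSucc ∈ A
          · simp [hlA, a, hj]
          · by_cases hjp : j.castSucc = parent i
            · rw [Set.piecewise_eq_of_notMem _ _ _ hlA]
              simp [b, hjp, hj, Nat.div_eq_of_lt q.2]
            · simp [hlA, b, hj, hjp]
    have hval (p q : Fin 2) : Φres (A.piecewise (a p) (b q)) =
        (1 / (√2 : ℂ)) ^ 15 * linkSign p 0 q := by
      rw [Φres_eq, Pi.smul_apply, smul_eq_mul, lift, hq, graphSign_resEdges,
        Fintype.prod_eq_single i]
      · simp [hne.symm]
      · intro j hj
        simp [hj, linkSign]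
    have hdet : (Matrix.of fun p q => Φres (A.piecewise (a p) (b q))).det =
        -2 * ((1 / (√2 : ℂ)) ^ 15) ^ 2 := by
      generalize (1 / (√2 : ℂ)) ^ 15 = c at hval
      simp only [hval, Matrix.det_fin_two, Matrix.of_apply]
      simp [linkSign, zSign]
      ring
    rw [hdet]
    exact mul_ne_zero (by norm_num) (pow_ne_zero _ (one_div_sqrt_two_pow_ne_zero 15))


/-! ### Preparation of the resource state -/

/-- The factorization of the system of a party into its target qubit and the rest. -/
def targetSplit (k : Fin 8) : Fin (d₀ k) ≃ Fin 2 × Fin (d₀ k / 2) :=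
  (finCongr (d₀_eq_mul k)).trans (finProdFinEquiv.symm.trans (Equiv.prodComm _ _))

theorem targetSplit_fst (k : Fin 8) (y : Fin (d₀ k)) : (targetSplit k y).1.val = y.val % 2 := rfl

theorem targetSplit_snd (k : Fin 8) (y : Fin (d₀ k)) : (targetSplit k y).2.val = y.val / 2 := rfl

theorem targetSplit_symm (k : Fin 8) (p : Fin 2) (q : Fin (d₀ k / 2)) :
    ((targetSplit k).symm (p, q)).val = p.val + 2 * q.val := rfl

/-- The communication of the target qubit of `k` into the target qubit of `l`. -/
def sendTarget (k l : Fin 8) (h : k ≠ l) : Communication d₀ where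
  sender := k
  receiver := l
  ne := h
  dim := 2
  restS := d₀ k / 2
  restR := d₀ l / 2
  splitS := targetSplit k
  splitR := targetSplit l

theorem isSingleQubit_sendTarget (k l : Fin 8) (h : k ≠ l) : (sendTarget k l h).IsSingleQubit :=
  ⟨rfl, ⟨.target, fun _ => ⟨rfl, rfl⟩⟩, ⟨.target, fun _ => ⟨rfl, rfl⟩⟩⟩

theorem qubitValues_exchange (k l : Fin 8) (h : k ≠ l) (x : Config d₀) :
    qubitValues ((sendTarget k l h).exchange x) =
      fun q => qubitValues x (Equiv.swap (.inl k) (.inl l) q) := by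
  have e : (sendTarget k l h).exchange x = Function.update (Function.update x k
      ((targetSplit k).symm ((targetSplit l (x l)).1, (targetSplit k (x k)).2))) l
      ((targetSplit l).symm ((targetSplit k (x k)).1, (targetSplit l (x l)).2)) := rfl
  rw [e, qubitValues_update_target, qubitValues_update_target]
  · ext q : 1
    by_cases hl : q = .inl l
    · subst hl
      simp [targetSplit_symm, targetSplit_fst, qubitValues_inl, Fin.ext_iff]
    · by_cases hk : q = .inl k
      · subst hk
        rw [Function.update_of_ne hl, Function.update_self, Equiv.swap_apply_left]
        simp [targetSplit_symm, targetSplit_fst, qubitValues_inl, Fin.ext_iff]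
      · rw [Function.update_of_ne hl, Function.update_of_ne hk, Equiv.swap_apply_of_ne_of_ne hk hl]
  · rw [targetSplit_symm, targetSplit_snd]
    omega
  · rw [targetSplit_symm, targetSplit_snd, Function.update_of_ne h.symm]
    omega

theorem transmit_lift (k l : Fin 8) (h : k ≠ l) (ψ : (Qubit → Fin 2) → ℂ) :
    (sendTarget k l h).transmit (lift ψ) =
      lift fun b => ψ fun q => b (Equiv.swap (.inl k) (.inl l) q) := by
  ext x
  simp only [Communication.transmit, lift, qubitValues_exchange]

theorem applyLocal_initPlus_target (k : Fin 8) (o : Fin 2) (ψ : (Qubit → Fin 2) → ℂ) :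
    applyLocal k (initPlus k .target o) (lift ψ) =
      (1 / (√2 : ℂ)) • lift fun b => ψ (Function.update b (.inl k) o) := by
  ext x
  have hlt : o.val + 2 * ((x k).val / 2) < d₀ k := by
    have := d₀_eq_mul k; have := (x k).2; omega
  rw [applyLocal, Fintype.sum_eq_single (⟨_, hlt⟩ : Fin (d₀ k))]
  · rw [lift, qubitValues_update_target x k _ (by simp only; omega)]
    have ho : Fin.ofNat 2 (o.val + 2 * ((x k).val / 2)) = o := by ext; simp; omega
    have hif : Slot.target.bit (o.val + 2 * ((x k).val / 2)) = o ∧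
        Slot.target.other.bit (x k) = Slot.target.other.bit (o.val + 2 * ((x k).val / 2)) := by
      simp only [Slot.bit, Slot.other]; omega
    simp only [initPlus, Matrix.of_apply, ho]
    rw [if_pos hif]
    rfl
  · intro y hy
    rw [initPlus, Matrix.of_apply, if_neg, zero_mul]
    rintro ⟨h1, h2⟩
    apply hy
    ext
    simp only [Slot.bit, Slot.other] at h1 h2 ⊢
    omega

theorem applyLocal_initPlus_auxiliary (i : Fin 7) (o : Fin 2) (ψ : (Qubit → Fin 2) → ℂ) :
    applyLocal i.castSucc (initPlus i.castSucc .auxiliary o) (lift ψ) =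
      (1 / (√2 : ℂ)) • lift fun b => ψ (Function.update b (.inr i) o) := by
  ext x
  have hlt : (x i.castSucc).val % 2 + 2 * o.val < d₀ i.castSucc := by
    have := d₀_castSucc i; omega
  rw [applyLocal, Fintype.sum_eq_single (⟨_, hlt⟩ : Fin (d₀ i.castSucc))]
  · rw [lift, qubitValues_update_aux x i _ (by simp only; omega)]
    have ho : Fin.ofNat 2 (((x i.castSucc).val % 2 + 2 * o.val) / 2) = o := by
      ext; simp; omega
    have hif : Slot.auxiliary.bit ((x i.castSucc).val % 2 + 2 * o.val) = o ∧
        Slot.auxiliary.other.bit (x i.castSucc) =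
          Slot.auxiliary.other.bit ((x i.castSucc).val % 2 + 2 * o.val) := by
      simp only [Slot.bit, Slot.other]; omega
    simp only [initPlus, Matrix.of_apply, ho]
    rw [if_pos hif]
    rfl
  · intro y hy
    rw [initPlus, Matrix.of_apply, if_neg, zero_mul]
    rintro ⟨h1, h2⟩
    apply hy
    ext
    simp only [Slot.bit, Slot.other] at h1 h2 ⊢
    omega

/-- The party that holds a qubit. -/
def Qubit.party : Qubit → Fin 8
  | .inl k => k
  | .inr i => i.castSucc

/-- The place of a qubit within the system of its party. -/
def Qubit.slot : Qubit → Slot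
  | .inl _ => .target
  | .inr _ => .auxiliary

theorem applyLocal_initPlus (q : Qubit) (o : Fin 2) (ψ : (Qubit → Fin 2) → ℂ) :
    applyLocal (Qubit.party q) (initPlus (Qubit.party q) (Qubit.slot q) o) (lift ψ) =
      (1 / (√2 : ℂ)) • lift fun b => ψ (Function.update b q o) := by
  rcases q with k | i
  · exact applyLocal_initPlus_target k o ψ
  · exact applyLocal_initPlus_auxiliary i o ψ

theorem inv_sqrt_two_mul_self : (√2 : ℂ)⁻¹ * (√2 : ℂ)⁻¹ = 1 / 2 := by
  rw [← mul_inv, ← Complex.ofReal_mul, Real.mul_self_sqrt two_pos.le]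
  simp

theorem sum_initPlus (q : Qubit) :
    ∑ j, (initPlus (Qubit.party q) (Qubit.slot q) j).conjTranspose *
      initPlus (Qubit.party q) (Qubit.slot q) j = 1 := by
  -- Abstracting the dimension lets a numeral replace it, so that all entries can be enumerated. In
  -- dimension 2 only the target slot gives a complete measurement.
  have key (n : ℕ) (s : Slot) (h : n = 4 ∨ n = 2 ∧ s = .target) :
      ∑ j : Fin 2, (Matrix.of fun y x : Fin n => if s.bit x = j ∧ s.other.bit y = s.other.bit x then
        1 / (√2 : ℂ) else 0).conjTranspose * (Matrix.of fun y x : Fin n =>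
          if s.bit x = j ∧ s.other.bit y = s.other.bit x then 1 / (√2 : ℂ) else 0) = 1 := by
    rcases h with rfl | ⟨rfl, rfl⟩
    · cases s <;> ext x x' <;> fin_cases x <;> fin_cases x' <;>
        simp [Matrix.mul_apply, Fin.sum_univ_succ, Slot.bit, Slot.other, inv_sqrt_two_mul_self] <;>
        norm_num
    · ext x x'
      fin_cases x <;> fin_cases x' <;>
        simp [Matrix.mul_apply, Fin.sum_univ_succ, Slot.bit, Slot.other, inv_sqrt_two_mul_self] <;>
        norm_num
  apply key
  rcases q with k | i
  · exact ((by decide : ∀ k : Fin 8, d₀ k = 4 ∨ d₀ k = 2) k).imp_right fun h => ⟨h, rfl⟩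
  · exact .inl (d₀_castSucc i)

theorem applyLocal_localCZ (i : Fin 7) (ψ : (Qubit → Fin 2) → ℂ) :
    applyLocal i.castSucc (localCZ i.castSucc) (lift ψ) =
      lift fun b => (if b (.inr i) = 1 ∧ b (.inl i.castSucc) = 1 then -1 else 1) * ψ b := by
  ext x
  rw [localCZ, applyLocal_diagonal, lift, lift]
  congr 1
  have h4 := lt_four _ (x i.castSucc)
  have hiff : (Slot.target.bit (x i.castSucc) = 1 ∧ Slot.auxiliary.bit (x i.castSucc) = 1) ↔
      (qubitValues x (.inr i) = 1 ∧ qubitValues x (.inl i.castSucc) = 1) := by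
    simp [Slot.bit, qubitValues_inl, qubitValues_inr, Fin.ext_iff]
    omega
  simp only [hiff]

theorem conjTranspose_localCZ_mul (k : Fin 8) :
    (localCZ k).conjTranspose * localCZ k = 1 := by
  rw [localCZ, Matrix.diagonal_conjTranspose, Matrix.diagonal_mul_diagonal, ← Matrix.diagonal_one]
  congr 1
  ext x
  simp only [Pi.star_apply]
  split_ifs <;> simp

/-- The elementary steps of the preparation. -/
inductive PrepStep
  | plus (q : Qubit)
  | link (i : Fin 7)
  | move (k l : Fin 8) (h : k ≠ l)

/-- The protocol that carries out the given steps. -/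
def prepProtocol : List PrepStep → Protocol d₀
  | [] => .halt
  | .plus q :: L => .measure (Qubit.party q) 2 (initPlus (Qubit.party q) (Qubit.slot q))
      fun _ => prepProtocol L
  | .link i :: L => .measure i.castSucc 1 (fun _ => localCZ i.castSucc) fun _ => prepProtocol L
  | .move k l h :: L => .send (sendTarget k l h) (prepProtocol L)

theorem isCZSequence_prepProtocol (L : List PrepStep) : IsCZSequence (prepProtocol L) := by
  induction L with
  | nil => exact .halt
  | cons s L ih =>
    cases s with
    | plus q => exact .initPlus _ _ _ ih
    | link i => exact .localCZ _ _ ih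
    | move k l h => exact .send _ _ (isSingleQubit_sendTarget k l h) ih

theorem isValid_prepProtocol (L : List PrepStep) : (prepProtocol L).IsValid := by
  induction L with
  | nil => trivial
  | cons s L ih =>
    cases s with
    | plus q => exact ⟨sum_initPlus q, fun _ => ih⟩
    | link i => exact ⟨by simpa using conjTranspose_localCZ_mul i.castSucc, fun _ => ih⟩
    | move k l h => exact ih

/-- The unnormalized state in which the qubits in `I` form a graph state with the edges `E` and the
others are in the state `|0⟩`. -/
def partialGraphKet (I : Finset Qubit) (E : List (Qubit × Qubit)) (b : Qubit → Fin 2) : ℂ :=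
  if ∀ q, q ∉ I → b q = 0 then graphSign E b else 0

/-- The steps `L` are admissible for the partial graph state with qubits `I` and edges `E`, and turn
it into the resource state. -/
def completes : List PrepStep → Finset Qubit → List (Qubit × Qubit) → Bool
  | [], I, E => decide (I = Finset.univ) && decide (E.Perm resEdges)
  | .plus q :: L, I, E =>
      decide (q ∉ I ∧ ∀ e ∈ E, e.1 ≠ q ∧ e.2 ≠ q) && completes L (insert q I) E
  | .link i :: L, I, E => completes L I ((.inr i, .inl i.castSucc) :: E)
  | .move k l _ :: L, I, E => decide (.inl l ∉ I) &&
      completes L (I.image (Equiv.swap (.inl k) (.inl l)))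
        (E.map (Prod.map (Equiv.swap (.inl k) (.inl l)) (Equiv.swap (.inl k) (.inl l))))

theorem graphSign_update {V : Type} [DecidableEq V] {E : List (V × V)} {q : V}
    (h : ∀ e ∈ E, e.1 ≠ q ∧ e.2 ≠ q) (b : V → Fin 2) (o : Fin 2) :
    graphSign E (Function.update b q o) = graphSign E b := by
  unfold graphSign
  congr 1
  refine List.map_congr_left fun e he => ?_
  rw [Function.update_of_ne (h e he).1, Function.update_of_ne (h e he).2]

/-- Initializing a qubit that is in `|0⟩`: outcome 1 has probability zero, and outcome 0 adds an
isolated vertex to the graph. -/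
theorem partialGraphKet_update {I : Finset Qubit} {E : List (Qubit × Qubit)} {q : Qubit}
    (hq : q ∉ I) (h : ∀ e ∈ E, e.1 ≠ q ∧ e.2 ≠ q) (b : Qubit → Fin 2) (o : Fin 2) :
    partialGraphKet I E (Function.update b q o) =
      (if o = 0 then 1 else 0) * partialGraphKet (insert q I) E b := by
  have hiff : (∀ r, r ∉ I → Function.update b q o r = 0) ↔
      o = 0 ∧ ∀ r, r ∉ insert q I → b r = 0 := by
    constructor
    · refine fun H => ⟨by simpa using H q hq, fun r hr => ?_⟩
      simp only [Finset.mem_insert, not_or] at hr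
      simpa [hr.1] using H r hr.2
    · rintro ⟨rfl, H⟩ r hr
      by_cases hrq : r = q
      · subst hrq; simp
      · rw [Function.update_of_ne hrq]
        exact H r (by simp [hrq, hr])
  simp only [partialGraphKet, hiff, graphSign_update h]
  by_cases ho : o = 0 <;> simp [ho]

/-- A communication permutes qubits by a swap; since this is an involution, pulling back labels
along `σ` amounts to pushing the graph forward along `σ`. -/
theorem partialGraphKet_perm {I : Finset Qubit} {E : List (Qubit × Qubit)} (σ : Equiv.Perm Qubit)
    (hσ : ∀ q, σ (σ q) = q) (b : Qubit → Fin 2) :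
    partialGraphKet I E (fun q => b (σ q)) =
      partialGraphKet (I.image σ) (E.map (Prod.map σ σ)) b := by
  have hiff : (∀ q, q ∉ I → b (σ q) = 0) ↔ ∀ q, q ∉ I.image σ → b q = 0 := by
    constructor
    · intro H q hq
      rw [← hσ q]
      exact H _ fun h => hq (Finset.mem_image.2 ⟨_, h, hσ q⟩)
    · intro H q hq
      exact H _ (by simpa using hq)
  simp only [partialGraphKet, hiff, graphSign, List.map_map]
  rfl

theorem transforms_prepProtocol (L : List PrepStep) (I : Finset Qubit) (E : List (Qubit × Qubit))
    (h : completes L I E = true) (c : ℂ) :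
    (prepProtocol L).Transforms (c • lift (partialGraphKet I E)) Φres := by
  induction L generalizing I E c with
  | nil =>
    simp only [completes, Bool.and_eq_true, decide_eq_true_eq] at h
    obtain ⟨rfl, hE⟩ := h
    refine ⟨c * ((1 / (√2 : ℂ)) ^ 15)⁻¹, ?_⟩
    rw [Φres_eq, smul_smul, mul_assoc, inv_mul_cancel₀ (one_div_sqrt_two_pow_ne_zero 15), mul_one]
    congr 2
    ext b
    simp only [partialGraphKet, Finset.mem_univ, not_true_eq_false, false_implies, implies_true,
      if_true, graphSign]
    exact (hE.map _).prod_eq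
  | cons s L ih =>
    cases s with
    | plus q =>
      simp only [completes, Bool.and_eq_true, decide_eq_true_eq] at h
      intro o
      rw [applyLocal_smul, applyLocal_initPlus]
      simp only [partialGraphKet_update h.1.1 h.1.2]
      -- The impossible outcome is covered too, as the induction allows the scalar `0`.
      have := ih _ _ h.2 (c * (1 / (√2 : ℂ)) * if o = 0 then 1 else 0)
      rw [mul_smul, mul_smul] at this
      exact this
    | link i =>
      intro _
      rw [applyLocal_smul, applyLocal_localCZ]
      convert ih _ _ h c using 3
      ext b
      simp only [partialGraphKet, graphSign, List.map_cons, List.prod_cons]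
      split_ifs <;> simp
    | move k l hkl =>
      simp only [completes, Bool.and_eq_true, decide_eq_true_eq] at h
      refine ⟨fun x hx => ?_, ?_⟩
      · have hl : qubitValues x (.inl l) ≠ 0 := fun h0 => hx (congrArg Fin.val h0)
        have : ¬ ∀ q, q ∉ I → qubitValues x q = 0 := fun H => hl (H _ h.1)
        rw [Pi.smul_apply, lift, partialGraphKet, if_neg this, smul_zero]
      · have e : (sendTarget k l hkl).transmit (c • lift (partialGraphKet I E)) =
            c • (sendTarget k l hkl).transmit (lift (partialGraphKet I E)) := rfl
        rw [e, transmit_lift]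
        simp only [partialGraphKet_perm _ (Equiv.swap_apply_self (Sum.inl k) (Sum.inl l))]
        exact ih _ _ h.2 c

theorem zeroKet_eq_lift : zeroKet d₀ = lift (partialGraphKet ∅ []) := by
  ext x
  have hiff : (∀ k, (x k).val = 0) ↔ ∀ q, q ∉ (∅ : Finset Qubit) → qubitValues x q = 0 := by
    constructor
    · rintro h (k | i) - <;> simp [qubitValues, h]
    · intro h k
      have ht := h (.inl k) (by simp)
      rw [qubitValues_inl, Fin.ext_iff] at ht
      induction k using Fin.lastCases with
      -- `v_8` has no auxiliary qubit: its label is the value of its target.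
      | last =>
        have : (x (Fin.last 7)).val < 2 := (x (Fin.last 7)).2
        exact (Nat.mod_eq_of_lt this).symm.trans ht
      | cast i =>
        have ha := h (.inr i) (by simp)
        rw [qubitValues_inr, Fin.ext_iff] at ha
        have := lt_four _ (x i.castSucc)
        simp at ht ha
        omega
  simp only [zeroKet, lift, partialGraphKet, hiff, graphSign, List.map_nil, List.prod_nil]

/-- A preparation of the resource state: each target qubit is created at one of the parties whose
auxiliary qubits it is to be linked to, visits the others, and ends at its own party. -/
def resourceSteps : List PrepStep :=
  (List.finRange 7).map (fun i => .plus (.inr i)) ++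
  -- The targets are treated from the root `v_8` down to the leaves: each visits the target slots of
  -- the children of its party, which must still be empty.
  [.plus (.inl 3), .link 3, .move 3 5 (by decide), .link 5, .move 5 6 (by decide), .link 6,
    .move 6 7 (by decide),
    .plus (.inl 1), .link 1, .move 1 2 (by decide), .link 2, .move 2 3 (by decide), .link 3,
    .plus (.inl 4), .link 4, .move 4 5 (by decide), .link 5,
    .plus (.inl 0), .link 0, .move 0 1 (by decide), .link 1,
    .plus (.inl 0), .link 0, .plus (.inl 2), .link 2, .plus (.inl 4), .link 4,
    .plus (.inl 6), .link 6]

theorem completes_resourceSteps : completes resourceSteps ∅ [] = true := by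
  decide

theorem transforms_zeroKet_Φres :
    (prepProtocol resourceSteps).Transforms (zeroKet d₀) Φres := by
  have := transforms_prepProtocol resourceSteps ∅ [] completes_resourceSteps 1
  rwa [one_smul, ← zeroKet_eq_lift] at this


/-! ### Transformation of the resource state into the target states -/

/-- The bra of the outcome `o` of the measurement of an auxiliary qubit. -/
def gateBra (θ : ℝ) (o a : Fin 2) : ℂ := if a = o then (Real.cos θ : ℂ) else Complex.I * Real.sin θ

/-- The Kraus operators of the measurement of the auxiliary qubit of `v_i`, which is reset to `|0⟩`,
followed by the outcome-dependent `Z` on the target qubit. -/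
def gateKraus (i : Fin 7) (θ : ℝ) (o : Fin 2) :
    Matrix (Fin (d₀ i.castSucc)) (Fin (d₀ i.castSucc)) ℂ :=
  Matrix.of fun y x => if y.val / 2 = 0 ∧ y.val % 2 = x.val % 2 then
    gateBra θ o (Fin.ofNat 2 (x.val / 2)) * (zSign (Fin.ofNat 2 x.val) : ℂ) ^ o.val else 0

/-- The correction `Z ^ o` of the target qubit of party `k`. -/
def zCorrection (k : Fin 8) (o : Fin 2) : Matrix (Fin (d₀ k)) (Fin (d₀ k)) ℂ :=
  Matrix.diagonal fun x => (zSign (Fin.ofNat 2 x.val) : ℂ) ^ o.val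

theorem zSign_mul_self (t : Fin 2) : zSign t * zSign t = 1 := by
  unfold zSign
  split_ifs <;> norm_num

theorem sum_gateKraus (i : Fin 7) (θ : ℝ) :
    ∑ o, (gateKraus i θ o).conjTranspose * gateKraus i θ o = 1 := by
  have hsc : Complex.cos θ ^ 2 + Complex.sin θ ^ 2 = 1 := Complex.cos_sq_add_sin_sq (θ : ℂ)
  have key (n : ℕ) (h : n = 4) :
      ∑ o : Fin 2, (Matrix.of fun y x : Fin n => if y.val / 2 = 0 ∧ y.val % 2 = x.val % 2 then
        gateBra θ o (Fin.ofNat 2 (x.val / 2)) * (zSign (Fin.ofNat 2 x.val) : ℂ) ^ o.val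
        else 0).conjTranspose *
      (Matrix.of fun y x : Fin n => if y.val / 2 = 0 ∧ y.val % 2 = x.val % 2 then
        gateBra θ o (Fin.ofNat 2 (x.val / 2)) * (zSign (Fin.ofNat 2 x.val) : ℂ) ^ o.val
        else 0) = 1 := by
    subst h
    ext x x'
    fin_cases x <;> fin_cases x' <;>
      simp [Matrix.mul_apply, Fin.sum_univ_succ, gateBra, zSign, ← Complex.cos_conj,
        ← Complex.sin_conj] <;>
      first
        | ring1
        | linear_combination hsc - Complex.sin θ ^ 2 * Complex.I_sq
  exact key _ (d₀_castSucc i)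

theorem conjTranspose_zCorrection_mul (k : Fin 8) (o : Fin 2) :
    (zCorrection k o).conjTranspose * zCorrection k o = 1 := by
  rw [zCorrection, Matrix.diagonal_conjTranspose, Matrix.diagonal_mul_diagonal,
    ← Matrix.diagonal_one]
  congr 1
  ext x
  simp only [Pi.star_apply, star_pow, ← mul_pow]
  have : star (zSign (Fin.ofNat 2 x.val) : ℂ) * zSign (Fin.ofNat 2 x.val) = 1 := by
    rw [Complex.star_def, Complex.conj_ofReal, ← Complex.ofReal_mul, zSign_mul_self,
      Complex.ofReal_one]
  rw [this, one_pow]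

theorem applyLocal_zCorrection (k : Fin 8) (o : Fin 2) (ψ : (Qubit → Fin 2) → ℂ) :
    applyLocal k (zCorrection k o) (lift ψ) =
      lift fun b => (zSign (b (.inl k)) : ℂ) ^ o.val * ψ b := by
  ext x
  rw [zCorrection, applyLocal_diagonal]
  rfl

theorem applyLocal_gateKraus (i : Fin 7) (θ : ℝ) (o : Fin 2) (ψ : (Qubit → Fin 2) → ℂ) :
    applyLocal i.castSucc (gateKraus i θ o) (lift ψ) = lift fun b =>
      if b (.inr i) = 0 then ∑ a, gateBra θ o a * (zSign (b (.inl i.castSucc)) : ℂ) ^ o.val *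
        ψ (Function.update b (.inr i) a) else 0 := by
  ext x
  rw [applyLocal, sum_localLabel, lift]
  have h4 := lt_four _ (x i.castSucc)
  have ha : qubitValues x (.inr i) = 0 ↔ (x i.castSucc).val / 2 = 0 := by
    simp [qubitValues_inr, Fin.ext_iff]
    omega
  have hlabel (t a : Fin 2) : Fin.ofNat 2 ((localLabel i t a).val / 2) = a ∧
      Fin.ofNat 2 (localLabel i t a).val = t ∧ (localLabel i t a).val % 2 = t.val := by
    simp [localLabel, Fin.ext_iff]
    omega
  simp only [ha]
  split_ifs with h0
  · refine Finset.sum_congr rfl fun a _ => ?_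
    rw [Fintype.sum_eq_single (qubitValues x (.inl i.castSucc))]
    · rw [lift, qubitValues_update_localLabel]
      obtain ⟨h1, h2, h3⟩ := hlabel (qubitValues x (.inl i.castSucc)) a
      simp only [gateKraus, Matrix.of_apply, h0, h1, h2, h3, true_and]
      rw [if_pos (by simp [qubitValues_inl])]
    · intro t ht
      obtain ⟨h1, h2, h3⟩ := hlabel t a
      simp only [gateKraus, Matrix.of_apply, h0, h3, true_and]
      rw [if_neg, zero_mul]
      intro h
      apply ht
      ext
      simp [qubitValues_inl, h]
  · refine Finset.sum_eq_zero fun a _ => Finset.sum_eq_zero fun t _ => ?_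
    rw [gateKraus, Matrix.of_apply, if_neg fun h => h0 h.1, zero_mul]

/-- The (unnormalized) ket with one factor for each gate, which depends on the auxiliary qubit of
the gate and on the two target qubits. -/
def gateProductKet (G : Fin 7 → Fin 2 → Fin 2 → Fin 2 → ℂ) (b : Qubit → Fin 2) : ℂ :=
  ∏ i, G i (b (.inr i)) (b (.inl i.castSucc)) (b (.inl (parent i)))

/-- The factor of a gate that has been applied. -/
def gateFactor (θ : ℝ) (a t t' : Fin 2) : ℂ :=
  if a = 0 then Complex.exp (Complex.I * (θ * zSign t * zSign t')) else 0

/-- With `s = z z'`, the measurement yields `cos θ · s ^ o + i sin θ · s ^ (1 - o) = s ^ o · exp(iθ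
s)`, because `s = ±1`. The corrections `z ^ o` and `z' ^ o` cancel `s ^ o`, so both outcomes give
the gate. -/
theorem sum_gateBra_mul_linkSign (θ : ℝ) (o t t' : Fin 2) :
    (zSign t' : ℂ) ^ o.val * ∑ a, gateBra θ o a * (zSign t : ℂ) ^ o.val * linkSign a t t' =
      Complex.exp (Complex.I * (θ * zSign t * zSign t')) := by
  have h1 : Complex.exp (Complex.I * θ) = Complex.cos θ + Complex.I * Complex.sin θ := by
    rw [mul_comm, Complex.exp_mul_I, mul_comm Complex.I]
  have h2 : Complex.exp (-(Complex.I * θ)) = Complex.cos θ - Complex.I * Complex.sin θ := by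
    rw [mul_comm, ← neg_mul, Complex.exp_mul_I, Complex.cos_neg, Complex.sin_neg]
    ring
  fin_cases o <;> fin_cases t <;> fin_cases t' <;>
    simp [gateBra, linkSign, zSign, h1, h2] <;> ring

theorem gateProductKet_eq_mul (G : Fin 7 → Fin 2 → Fin 2 → Fin 2 → ℂ) (i : Fin 7)
    (b : Qubit → Fin 2) :
    gateProductKet G b = G i (b (.inr i)) (b (.inl i.castSucc)) (b (.inl (parent i))) *
      ∏ j ∈ Finset.univ.erase i, G j (b (.inr j)) (b (.inl j.castSucc)) (b (.inl (parent j))) :=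
  (Finset.mul_prod_erase _ _ (Finset.mem_univ i)).symm

/-- One step of the protocol applies one gate. -/
theorem applyLocal_gate {G : Fin 7 → Fin 2 → Fin 2 → Fin 2 → ℂ} {i : Fin 7} (hG : G i = linkSign)
    (θ : ℝ) (o : Fin 2) :
    applyLocal (parent i) (zCorrection (parent i) o)
      (applyLocal i.castSucc (gateKraus i θ o) (lift (gateProductKet G))) =
      lift (gateProductKet (Function.update G i (gateFactor θ))) := by
  rw [applyLocal_gateKraus, applyLocal_zCorrection]
  congr 1
  ext b
  rw [gateProductKet_eq_mul _ i, Function.update_self, gateFactor]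
  have hrest : ∏ j ∈ Finset.univ.erase i, Function.update G i (gateFactor θ) j (b (.inr j))
      (b (.inl j.castSucc)) (b (.inl (parent j))) =
      ∏ j ∈ Finset.univ.erase i, G j (b (.inr j)) (b (.inl j.castSucc)) (b (.inl (parent j))) :=
    Finset.prod_congr rfl fun j hj => by rw [Function.update_of_ne (Finset.ne_of_mem_erase hj)]
  rw [hrest]
  split_ifs with h0
  · rw [← sum_gateBra_mul_linkSign θ o, mul_assoc, Finset.sum_mul]
    congr 1
    refine Finset.sum_congr rfl fun a _ => ?_
    rw [gateProductKet_eq_mul _ i, hG, ← mul_assoc]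
    congr 1
    · simp
    -- The remaining factors do not involve the auxiliary qubit of `v_i`.
    · refine Finset.prod_congr rfl fun j hj => ?_
      simp [Finset.ne_of_mem_erase hj]
  · simp

/-- The protocol that applies the gates in the list `L`. -/
def gateProtocol (α : Fin 7 → ℝ) : List (Fin 7) → Protocol d₀
  | [] => .halt
  | i :: L => .measure i.castSucc 2 (gateKraus i (α i)) fun o =>
      .measure (parent i) 1 (fun _ => zCorrection (parent i) o) fun _ => gateProtocol α L

theorem isLOCC_gateProtocol (α : Fin 7 → ℝ) (L : List (Fin 7)) : (gateProtocol α L).IsLOCC := by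
  induction L with
  | nil => exact ⟨trivial, trivial⟩
  | cons i L ih =>
    exact ⟨⟨sum_gateKraus i (α i), fun o =>
      ⟨by simpa using conjTranspose_zCorrection_mul (parent i) o, fun _ => ih.1⟩⟩,
      fun _ _ => ih.2⟩

/-- `gateFactor` vanishes when its auxiliary qubit is 1, which matches the support of the embedding.
-/
theorem embed_targetKet (α : Fin 7 → ℝ) :
    embed d₀ (targetKet α) =
      (1 / (√2 : ℂ)) ^ 8 • lift (gateProductKet fun i => gateFactor (α i)) := by
  ext x
  have hlt (i : Fin 7) : (x i.castSucc).val < 2 ↔ qubitValues x (.inr i) = 0 := by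
    have := lt_four _ (x i.castSucc)
    simp [qubitValues_inr, Fin.ext_iff]
    omega
  rw [Pi.smul_apply, smul_eq_mul, lift, gateProductKet, embed]
  split_ifs with h
  · have := targetKet_apply α fun k => ⟨(x k).val, h k⟩
    refine this.trans ?_
    congr 1
    refine Finset.prod_congr rfl fun i _ => ?_
    rw [gateFactor, if_pos ((hlt i).1 (h _))]
    have hq (k : Fin 8) : (⟨(x k).val, h k⟩ : Fin 2) = qubitValues x (.inl k) :=
      Fin.ext (Nat.mod_eq_of_lt (h k)).symm
    rw [← hq, ← hq]
  · have : ∃ i : Fin 7, qubitValues x (.inr i) ≠ 0 := by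
      by_contra! H
      refine h fun k => ?_
      induction k using Fin.lastCases with
      | last => exact (x (Fin.last 7)).2
      | cast i => exact (hlt i).2 (H i)
    obtain ⟨i, hi⟩ := this
    rw [Finset.prod_eq_zero (Finset.mem_univ i), mul_zero]
    rw [gateFactor, if_neg hi]

/-- Invariant: the gates still in `L` carry the factor of the resource state, the others that of the
target. `L.Nodup` ensures that no auxiliary qubit is used twice. -/
theorem transforms_gateProtocol (α : Fin 7 → ℝ) (L : List (Fin 7)) (hL : L.Nodup)
    (G : Fin 7 → Fin 2 → Fin 2 → Fin 2 → ℂ) (hG : ∀ i ∈ L, G i = linkSign)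
    (hG' : ∀ i ∉ L, G i = gateFactor (α i)) (c : ℂ) :
    (gateProtocol α L).Transforms (c • lift (gateProductKet G)) (embed d₀ (targetKet α)) := by
  induction L generalizing G with
  | nil =>
    obtain rfl : G = fun i => gateFactor (α i) := funext fun i => hG' i (by simp)
    refine ⟨c * ((1 / (√2 : ℂ)) ^ 8)⁻¹, ?_⟩
    rw [embed_targetKet, smul_smul, mul_assoc,
      inv_mul_cancel₀ (one_div_sqrt_two_pow_ne_zero 8), mul_one]
  | cons i L ih =>
    intro o _
    rw [applyLocal_smul, applyLocal_smul, applyLocal_gate (hG i (by simp))]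
    have hi := List.nodup_cons.1 hL
    refine ih hi.2 _ (fun j hj => ?_) fun j hj => ?_
    · rw [Function.update_of_ne (ne_of_mem_of_not_mem hj hi.1)]
      exact hG j (by simp [hj])
    · by_cases hji : j = i
      · subst hji; simp
      · rw [Function.update_of_ne hji]
        exact hG' j (by simp [hji, hj])

theorem achievesStatic_Φres : AchievesStatic Φres S₀ := by
  rintro _ ⟨α, -, rfl⟩
  refine ⟨gateProtocol α (List.finRange 7), isLOCC_gateProtocol _ _, ?_⟩
  have e : graphSign resEdges = gateProductKet fun _ => linkSign := funext graphSign_resEdges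
  rw [Φres_eq, e]
  exact transforms_gateProtocol α _ (List.nodup_finRange 7) _ (fun _ _ => rfl)
    (fun i hi => (hi (List.mem_finRange i)).elim) _

end SizeLimited

end

theorem proposition3 :
    SizeLimited.IsState SizeLimited.Φres ∧
    SizeLimited.FullyEntangled SizeLimited.Φres ∧
    (∃ P : SizeLimited.Protocol SizeLimited.d₀, P.IsValid ∧ SizeLimited.IsCZSequence P ∧
      P.Transforms (SizeLimited.zeroKet SizeLimited.d₀) SizeLimited.Φres) ∧
    SizeLimited.AchievesDynamic SizeLimited.Φres SizeLimited.S₀ ∧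
    ∀ φ : SizeLimited.Ket SizeLimited.d₀,
      SizeLimited.IsState φ → SizeLimited.ConsistsOfBipartite φ →
        ¬ SizeLimited.AchievesStatic φ SizeLimited.S₀ := by
  have hprep := SizeLimited.isValid_prepProtocol SizeLimited.resourceSteps
  exact ⟨SizeLimited.isState_Φres, SizeLimited.fullyEntangled_Φres,
    ⟨_, hprep, SizeLimited.isCZSequence_prepProtocol _, SizeLimited.transforms_zeroKet_Φres⟩,
    ⟨⟨_, hprep, SizeLimited.transforms_zeroKet_Φres⟩, SizeLimited.achievesStatic_Φres⟩,
    fun _ hφ hb => SizeLimited.not_achievesStatic_of_consistsOfBipartite hφ hb⟩
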